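/- Let $E\subset\mathbb R^n$ be compact, $\alpha>0$, $\upsilon\in\mathbb R$ and $q>\upsilon+\alpha$. For a multi-index $j\in\mathbb N^n$ let $|j|$ be its length. A jet of order $\alpha$ on a set $S\subset\mathbb R^n$ is a family $f=(f_j)_{|j|\le\alpha}$ of real functions on $S$; put $$T^\alpha_yf(x)=\sum_{|j|\le\alpha}\frac1{j!}f_j(y)(x-y)^j,\qquad \Delta_j(y,x)=f_j(x)-D^j_xT^\alpha_yf(x),$$ $$\|f\|_{\mathrm{Lip}_\alpha(S)}=\sum_{|j|\le\alpha}\Big(\sup_S|f_j|+\sup_{x,y\in S,\,x\ne y}\frac{|\Delta_j(y,x)|}{|x-y|^{\alpha-|j|}}\Big),$$ and let $\mathrm{Lip}_\alpha(S)$ be the set of jets of order $\alpha$ on $S$ with all $f_j$ continuous on $S$ and $\|f\|_{\mathrm{Lip}_\alpha(S)}<\infty$. Let $\mu\in U_\upsilon(E)$, that is, $\mu$ is a Borel probability measure with support $E$ and there is a constant $C$ with $\mu(B(x,kr))\le Ck^{\upsilon}\mu(B(x,r))$ for all $x\in E$ and $0<r<kr\le1$. Let $f\in\mathrm{Lip}_\alpha(E)$,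 and for $x\notin E$ put $$h_q(x)=\int_E|x-y|^{-q}\,d\mu(y),\qquad \mathcal E(f)(x)=\frac1{h_q(x)}\int_E|x-y|^{-q}\,T^\alpha_yf(x)\,d\mu(y).$$ Let $g=f_0$ on $E$ and $g=\mathcal E(f)$ on $\mathbb R^n\setminus E$, and, for $|j|\le\alpha$, let $g_j=f_j$ on $E$ and $g_j=D^j\mathcal E(f)$ on $\mathbb R^n\setminus E$. Then: 1. $\mathcal E(f)\in C^\infty(\mathbb R^n\setminus E)$; $g\in C^k(\mathbb R^n)$ for every integer $0\le k<\alpha$; and $D^jg=g_j$ on $\mathbb R^n$ for $|j|<\alpha$. 2. For every $R>0$, $\|(g_j)_{|j|\le\alpha}\|_{\mathrm{Lip}_\alpha(B(0,R))}<\infty$; if $\alpha$ is not an integer, then $(g_j)_{|j|\le\alpha}\in\mathrm{Lip}_\alpha(B(0,R))$. 3. For every $\alpha>0$ there is a family $(G_j)_{|j|\le\alpha}$ of functions on $\mathbb R^n$ with $G_j=g_j$ for $|j|<\alpha$ (in particular $G_0=g$) and $G_j=f_j$ on $E$ for $|j|\le\alpha$, such that $(G_j)_{|j|\le\alpha}\in\mathrm{Lip}_\alpha(B(0,R))$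 for every $R>0$. -/

import Mathlib

open MeasureTheory
open scoped ENNReal ContDiff

noncomputable section

namespace WhitneyDoubling

/-- `ℝⁿ` with its Euclidean metric. -/
abbrev Eucl (n : ℕ) : Type := EuclideanSpace ℝ (Fin n)

/-- Length `|j|` of a multi-index. -/
def len {n : ℕ} (j : Fin n → ℕ) : ℕ := ∑ i, j i

/-- The finite set of multi-indices `j` with `|j| ≤ α`. -/
def indices (n : ℕ) (α : ℝ) : Finset (Fin n → ℕ) :=
  (Fintype.piFinset fun _ : Fin n => Finset.range (⌊α⌋₊ + 1)).filter
    fun j => (len j : ℝ) ≤ α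

theorem mem_indices {n : ℕ} {α : ℝ} {j : Fin n → ℕ} :
    j ∈ indices n α ↔ (len j : ℝ) ≤ α := by
  unfold indices
  rw [Finset.mem_filter, Fintype.mem_piFinset, and_iff_right_iff_imp]
  intro h i
  rw [Finset.mem_range, Nat.lt_succ_iff]
  exact (Finset.single_le_sum (f := j) (fun _ _ => Nat.zero_le _) (Finset.mem_univ i)).trans
    (Nat.le_floor h)

/-- The partial derivative `∂F / ∂xᵢ`. -/
def partialDeriv {n : ℕ} (i : Fin n) (F : Eucl n → ℝ) : Eucl n → ℝ :=
  fun x => lineDeriv ℝ F x (EuclideanSpace.single i 1)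

/-- The iterated partial derivative `D^j F = ∂₁^{j₁} ⋯ ∂ₙ^{jₙ} F`. -/
def multiDeriv {n : ℕ} (j : Fin n → ℕ) (F : Eucl n → ℝ) : Eucl n → ℝ :=
  (List.finRange n).foldr (fun i H => (partialDeriv i)^[j i] H) F

/-- A family `(f_j)` of functions indexed by multi-indices. For a jet of order `α` on a set `S`,
only the values `f j x` with `|j| ≤ α` and `x ∈ S` are used. -/
abbrev Jet (n : ℕ) : Type := (Fin n → ℕ) → Eucl n → ℝ

/-- The Taylor polynomial `T^α_y f (x) = ∑_{|j| ≤ α} f_j(y) (x - y)^j / j!`. -/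
def taylor {n : ℕ} (α : ℝ) (f : Jet n) (y x : Eucl n) : ℝ :=
  ∑ j ∈ indices n α, (∏ i, ((j i).factorial : ℝ))⁻¹ * f j y * ∏ i, (x i - y i) ^ j i

/-- `Δ_j(y, x) = f_j(x) - D_x^j T^α_y f (x)`. -/
def remainder {n : ℕ} (α : ℝ) (f : Jet n) (j : Fin n → ℕ) (y x : Eucl n) : ℝ :=
  f j x - multiDeriv j (taylor α f y) x

/-- The norm `∑_{|j| ≤ α} (sup_S |f_j| + sup_{x, y ∈ S} |Δ_j(y, x)| / |x - y|^{α - |j|})`,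
with values in `[0, ∞]`. The diagonal `x = y` contributes `0`. -/
def lipNorm {n : ℕ} (α : ℝ) (S : Set (Eucl n)) (f : Jet n) : ℝ≥0∞ :=
  ∑ j ∈ indices n α,
    ((⨆ x ∈ S, ENNReal.ofReal |f j x|) +
      ⨆ x ∈ S, ⨆ y ∈ S,
        ENNReal.ofReal (|remainder α f j y x| / dist x y ^ (α - (len j : ℝ))))

/-- `f ∈ Lip_α(S)`: a jet of continuous functions on `S` with finite norm. -/
def MemLip {n : ℕ} (α : ℝ) (S : Set (Eucl n)) (f : Jet n) : Prop :=
  (∀ j, (len j : ℝ) ≤ α → ContinuousOn (f j) S) ∧ lipNorm α S f ≠ ⊤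

/-- `μ ∈ U_υ(E)`: `μ` is a probability measure with support `E` such that, for some constant `C`,
`μ(B(x, kr)) ≤ C k^υ μ(B(x, r))` for all `x ∈ E` and `0 < r < kr ≤ 1`. -/
structure MemU {n : ℕ} (υ : ℝ) (E : Set (Eucl n)) (μ : Measure (Eucl n)) : Prop where
  prob : IsProbabilityMeasure μ
  supp : μ.support = E
  growth : ∃ C : ℝ, ∀ x ∈ E, ∀ r k : ℝ, 0 < r → r < k * r → k * r ≤ 1 →
    μ.real (Metric.ball x (k * r)) ≤ C * k ^ υ * μ.real (Metric.ball x r)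

/-- `h_q(x) = ∫_E |x - y|^{-q} dμ(y)`. -/
def hWeight {n : ℕ} (E : Set (Eucl n)) (μ : Measure (Eucl n)) (q : ℝ) (x : Eucl n) : ℝ :=
  ∫ y in E, dist x y ^ (-q) ∂μ

/-- The extension operator `𝓔(f)(x) = h_q(x)⁻¹ ∫_E |x - y|^{-q} T^α_y f (x) dμ(y)`. -/
def extOp {n : ℕ} (E : Set (Eucl n)) (μ : Measure (Eucl n)) (q α : ℝ) (f : Jet n)
    (x : Eucl n) : ℝ :=
  (hWeight E μ q x)⁻¹ * ∫ y in E, dist x y ^ (-q) * taylor α f y x ∂μ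

open Classical in
/-- The function `g`, equal to `f₀` on `E` and to `𝓔(f)` off `E`. -/
def extFun {n : ℕ} (E : Set (Eucl n)) (μ : Measure (Eucl n)) (q α : ℝ) (f : Jet n)
    (x : Eucl n) : ℝ :=
  if x ∈ E then f 0 x else extOp E μ q α f x

open Classical in
/-- The jet of `g`: `f_j` on `E` and `D^j 𝓔(f)` off `E`. -/
def extJet {n : ℕ} (E : Set (Eucl n)) (μ : Measure (Eucl n)) (q α : ℝ) (f : Jet n) : Jet n :=
  fun j x => if x ∈ E then f j x else multiDeriv j (extOp E μ q α f) x

end WhitneyDoubling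

end

noncomputable section

namespace WhitneyDoubling

variable {n : ℕ}

/-! ### Multi-indices and monomials -/

/-! Off `E` write d = d(x, E), let a be a nearest point of `E` to x, and let `T_a f` be the Taylor
polynomial of the jet at a. Everything rests on the estimate |D^j(𝓔(f) - T_a f)(x)| ≤ C d^(α - |j|),
valid for every j (`MemU.exists_abs_multiDeriv_extOp_sub_le`). To get it, expand T_y f - T_a f about
y: its coefficients f_l(y) - D^l T_a f(y) are the Whitney remainders of f, of size |a - y|^(α - |l|)
≤ C |x - y|^(α - |l|). So 𝓔(f) - T_a f is 1/h_q times a sum of integrals of these remainders against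
the homogeneous kernels |z|^(-q) z^l / l!, and m derivatives of such an integral cost a factor
d^(-m), leaving ∫ |x - y|^(α - q) dμ.

The measure enters in `MemU.exists_riesz_le`: this last integral is at most C d^α h_q(x). Near `E`,
dyadic shells around a give a geometric series of ratio 2^(υ + α - q) < 1, with sum comparable to
d^(α - q) μ(B(a, 2d)), while h_q(x) is at least a multiple of d^(-q) μ(B(a, 2d)). Derivatives of
1/h_q also cost d^(-m) each, and Leibniz' rule finishes the estimate.

When |j| = ⌊α⌋ + 1 the polynomial disappears and the same estimate bounds D^j 𝓔(f) by C d^(α - |j|).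
Taylor's formula then compares two points whose distance is small relative to d, and other pairs are
compared through points of `E` (`exists_jetNear_of_compact`). The result is the Whitney condition
for the glued jet on all of ℝⁿ. It makes the components of order below α continuous, and makes each
g_j with |j| + 1 < α differentiable with the expected derivative.

For integer α the components with |j| = α may be discontinuous at `E`. In that order the condition
is mere boundedness, so on a ball they can be replaced by any continuous extensions of the f_j. -/

theorem len_add (j l : Fin n → ℕ) : len (j + l) = len j + len l := by
  simp [len, Finset.sum_add_distrib]

@[simp] theorem len_single (i : Fin n) (p : ℕ) : len (Pi.single i p : Fin n → ℕ) = p := by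
  simp [len]

@[simp] theorem len_zero : len (0 : Fin n → ℕ) = 0 := by
  simp [len]

/-- The normalized monomial `z^l / l!`. -/
def mono (l : Fin n → ℕ) (z : Eucl n) : ℝ := ∏ i, z i ^ l i / ((l i).factorial : ℝ)

theorem mono_zero (z : Eucl n) : mono 0 z = 1 := by simp [mono]

theorem mono_apply_zero {l : Fin n → ℕ} (hl : l ≠ 0) : mono l (0 : Eucl n) = 0 := by
  obtain ⟨i, hi⟩ := Function.ne_iff.1 hl
  refine Finset.prod_eq_zero (Finset.mem_univ i) ?_
  simp only [Pi.zero_apply] at hi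
  simp [hi]

theorem abs_mono_le (l : Fin n → ℕ) (z : Eucl n) : |mono l z| ≤ ‖z‖ ^ len l := by
  rw [mono, Finset.abs_prod, len, ← Finset.prod_pow_eq_pow_sum]
  refine Finset.prod_le_prod (fun _ _ => abs_nonneg _) fun i _ => ?_
  rw [abs_div, abs_pow, Nat.abs_cast]
  have h1 : |z i| ≤ ‖z‖ := by simpa using PiLp.norm_apply_le z i
  calc |z i| ^ l i / ((l i).factorial : ℝ) ≤ |z i| ^ l i :=
        div_le_self (by positivity) (Nat.one_le_cast.2 (Nat.factorial_pos _))
    _ ≤ ‖z‖ ^ l i := by gcongr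

theorem mono_smul (l : Fin n → ℕ) (t : ℝ) (z : Eucl n) : mono l (t • z) = t ^ len l * mono l z := by
  rw [mono, mono, len, ← Finset.prod_pow_eq_pow_sum, ← Finset.prod_mul_distrib]
  refine Finset.prod_congr rfl fun i _ => ?_
  simp [mul_pow, mul_div_assoc]

theorem contDiff_mono (l : Fin n → ℕ) : ContDiff ℝ ∞ (mono l : Eucl n → ℝ) := by
  unfold mono
  fun_prop

theorem hasDerivAt_pow_div_factorial (p : ℕ) (t : ℝ) :
    HasDerivAt (fun t : ℝ => t ^ (p + 1) / ((p + 1).factorial : ℝ)) (t ^ p / (p.factorial : ℝ)) t := by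
  refine ((hasDerivAt_pow (p + 1) t).div_const _).congr_deriv ?_
  have : (p.factorial : ℝ) ≠ 0 := by exact_mod_cast p.factorial_ne_zero
  rw [Nat.factorial_succ]
  push_cast
  field_simp

/-- The partial derivative of `mono l` in the direction `i`. -/
def monoPartial (l : Fin n → ℕ) (i : Fin n) (z : Eucl n) : ℝ :=
  if l i = 0 then 0 else mono (l - Pi.single i 1) z

theorem mono_eq_mul_erase (l : Fin n → ℕ) (i : Fin n) (z : Eucl n) :
    mono l z = (z i ^ l i / ((l i).factorial : ℝ)) *
      ∏ k ∈ Finset.univ.erase i, z k ^ l k / ((l k).factorial : ℝ) :=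
  (Finset.mul_prod_erase _ _ (Finset.mem_univ i)).symm

theorem hasFDerivAt_mono (l : Fin n → ℕ) (z : Eucl n) :
    HasFDerivAt (mono l) (∑ i, monoPartial l i z • (EuclideanSpace.proj i : Eucl n →L[ℝ] ℝ)) z := by
  have h : ∀ i ∈ (Finset.univ : Finset (Fin n)),
      HasFDerivAt (fun w : Eucl n => w i ^ l i / ((l i).factorial : ℝ))
        ((if l i = 0 then 0 else z i ^ (l i - 1) / ((l i - 1).factorial : ℝ)) •
          (EuclideanSpace.proj i : Eucl n →L[ℝ] ℝ)) z := by
    intro i _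
    have hp : HasFDerivAt (fun w : Eucl n => w i) (EuclideanSpace.proj i : Eucl n →L[ℝ] ℝ) z :=
      (EuclideanSpace.proj i : Eucl n →L[ℝ] ℝ).hasFDerivAt
    rcases hl : l i with _ | p
    · simpa using hasFDerivAt_const (1 : ℝ) z
    · rw [if_neg p.succ_ne_zero, Nat.add_sub_cancel]
      exact (hasDerivAt_pow_div_factorial p (z i)).comp_hasFDerivAt z hp
  refine (HasFDerivAt.finsetProd h).congr_fderiv ?_
  refine Finset.sum_congr rfl fun i _ => ?_
  rw [smul_smul]
  congr 1
  rw [monoPartial]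
  split_ifs with hi
  · simp
  · rw [mono_eq_mul_erase _ i, mul_comm]
    congr 1
    · simp
    · refine Finset.prod_congr rfl fun k hk => ?_
      have : k ≠ i := Finset.ne_of_mem_erase hk
      simp [this]

/-! ### Families of successive partial derivatives -/

/-- The functions `F j` with `|j| ≤ m` are the successive partial derivatives of `F 0` on `U`. -/
def IsDerivFamily (m : ℕ) (U : Set (Eucl n)) (F : Jet n) : Prop :=
  ∀ j, len j < m → ∀ z ∈ U,
    HasFDerivAt (F j) (∑ i, F (j + Pi.single i 1) z • (EuclideanSpace.proj i : Eucl n →L[ℝ] ℝ)) z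

theorem IsDerivFamily.sub {m : ℕ} {U : Set (Eucl n)} {F G : Jet n} (hF : IsDerivFamily m U F)
    (hG : IsDerivFamily m U G) : IsDerivFamily m U (fun j z => F j z - G j z) := by
  intro j hj z hz
  refine ((hF j hj z hz).sub (hG j hj z hz)).congr_fderiv ?_
  simp only [sub_smul, Finset.sum_sub_distrib]

theorem IsDerivFamily.mono_set {m : ℕ} {U V : Set (Eucl n)} {F : Jet n} (h : IsDerivFamily m U F)
    (hV : V ⊆ U) : IsDerivFamily m V F := fun j hj z hz => h j hj z (hV hz)

theorem partialDeriv_congr {U : Set (Eucl n)} (hU : IsOpen U) {F G : Eucl n → ℝ} (h : Set.EqOn F G U)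
    (i : Fin n) : Set.EqOn (partialDeriv i F) (partialDeriv i G) U := fun _ hx =>
  Filter.EventuallyEq.lineDeriv_eq (h.eventuallyEq_of_mem (hU.mem_nhds hx))

theorem partialDeriv_eq_of_hasFDerivAt {F : Eucl n → ℝ} {x : Eucl n} {F' : Eucl n →L[ℝ] ℝ}
    (h : HasFDerivAt F F' x) (i : Fin n) : partialDeriv i F x = F' (EuclideanSpace.single i 1) :=
  (h.hasLineDerivAt _).lineDeriv

theorem sum_smul_proj_single (c : Fin n → ℝ) (i : Fin n) :
    (∑ k, c k • (EuclideanSpace.proj k : Eucl n →L[ℝ] ℝ)) (EuclideanSpace.single i 1) = c i := by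
  simp

theorem IsDerivFamily.partialDeriv_eqOn {m : ℕ} {U : Set (Eucl n)} {F : Jet n}
    (h : IsDerivFamily m U F) {j : Fin n → ℕ} (hj : len j < m) (i : Fin n) :
    Set.EqOn (partialDeriv i (F j)) (F (j + Pi.single i 1)) U := fun z hz => by
  rw [partialDeriv_eq_of_hasFDerivAt (h j hj z hz), sum_smul_proj_single]

theorem IsDerivFamily.iterate_eqOn {m : ℕ} {U : Set (Eucl n)} {F : Jet n} (hU : IsOpen U)
    (h : IsDerivFamily m U F) (i : Fin n) (p : ℕ) {j : Fin n → ℕ} (hj : len j + p ≤ m)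
    {H : Eucl n → ℝ} (hH : Set.EqOn H (F j) U) :
    Set.EqOn ((partialDeriv i)^[p] H) (F (j + Pi.single i p)) U := by
  induction p with
  | zero => simpa using hH
  | succ p ih =>
    rw [Function.iterate_succ_apply']
    have h1 := h.partialDeriv_eqOn (j := j + Pi.single i p) (by rw [len_add, len_single]; omega) i
    rw [add_assoc, ← Pi.single_add] at h1
    exact (partialDeriv_congr hU (ih (by omega)) i).trans h1

theorem IsDerivFamily.foldr_eqOn {m : ℕ} {U : Set (Eucl n)} {F : Jet n} (hU : IsOpen U)
    (h : IsDerivFamily m U F) (j : Fin n → ℕ) (L : List (Fin n))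
    (hL : len ((L.map fun i => (Pi.single i (j i) : Fin n → ℕ)).sum) ≤ m) :
    Set.EqOn (L.foldr (fun i H => (partialDeriv i)^[j i] H) (F 0))
      (F (L.map fun i => (Pi.single i (j i) : Fin n → ℕ)).sum) U := by
  induction L with
  | nil => intro x _; simp
  | cons i L ih =>
    rw [List.map_cons, List.sum_cons, len_add, len_single] at hL
    rw [List.foldr_cons, List.map_cons, List.sum_cons, add_comm]
    exact h.iterate_eqOn hU i (j i) (by omega) (ih (by omega))

/-- Each partial derivative moves the index of the family by one unit vector. Addition of indices is
commutative, so the order fixed in `multiDeriv` is irrelevant and no symmetry of mixed derivatives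
is needed here. -/
theorem IsDerivFamily.multiDeriv_eqOn {m : ℕ} {U : Set (Eucl n)} {F : Jet n} (hU : IsOpen U)
    (h : IsDerivFamily m U F) {j : Fin n → ℕ} (hj : len j ≤ m) :
    Set.EqOn (multiDeriv j (F 0)) (F j) U := by
  have hs : ((List.finRange n).map fun i => (Pi.single i (j i) : Fin n → ℕ)).sum = j := by
    rw [← Fin.sum_univ_def, Finset.univ_sum_single]
  have := h.foldr_eqOn hU j (List.finRange n) (by rwa [hs])
  rwa [hs] at this

/-! ### Taylor polynomials of jets -/

/-- The jet that agrees with `f` for `|j| ≤ α` and vanishes for `|j| > α`. -/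
def trunc (α : ℝ) (f : Jet n) : Jet n := fun j x => if (len j : ℝ) ≤ α then f j x else 0

theorem trunc_of_le {α : ℝ} {f : Jet n} {j : Fin n → ℕ} (h : (len j : ℝ) ≤ α) :
    trunc α f j = f j := by
  funext x
  simp [trunc, h]

theorem trunc_of_lt {α : ℝ} {f : Jet n} {j : Fin n → ℕ} (h : α < len j) :
    trunc α f j = 0 := by
  funext x
  simp [trunc, h]

/-- `polyJet α f y j` is the derivative `D^j T^α_y f` of the Taylor polynomial. -/
def polyJet (α : ℝ) (f : Jet n) (y : Eucl n) : Jet n := fun j x =>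
  ∑ l ∈ indices n α, trunc α f (j + l) y * mono l (x - y)

theorem taylor_eq_polyJet (α : ℝ) (f : Jet n) (y x : Eucl n) :
    taylor α f y x = polyJet α f y 0 x := by
  refine Finset.sum_congr rfl fun l hl => ?_
  rw [zero_add, trunc_of_le (mem_indices.1 hl), mono]
  simp only [PiLp.sub_apply, Finset.prod_div_distrib]
  ring

theorem zero_mem_indices {α : ℝ} (hα : 0 ≤ α) : (0 : Fin n → ℕ) ∈ indices n α := by
  simpa [mem_indices] using hα

theorem polyJet_self {α : ℝ} (hα : 0 ≤ α) (f : Jet n) (y : Eucl n) (j : Fin n → ℕ) :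
    polyJet α f y j y = trunc α f j y := by
  rw [polyJet, Finset.sum_eq_single_of_mem 0 (zero_mem_indices hα)]
  · simp [mono_zero]
  · intro l _ hl
    rw [sub_self, mono_apply_zero hl, mul_zero]

theorem polyJet_of_lt {α : ℝ} {f : Jet n} {y : Eucl n} {j : Fin n → ℕ} (h : α < len j)
    (x : Eucl n) : polyJet α f y j x = 0 := by
  refine Finset.sum_eq_zero fun l _ => ?_
  rw [trunc_of_lt, Pi.zero_apply, zero_mul]
  rw [len_add]
  push_cast
  have : (0 : ℝ) ≤ len l := Nat.cast_nonneg _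
  linarith

theorem contDiff_polyJet (α : ℝ) (f : Jet n) (y : Eucl n) (j : Fin n → ℕ) :
    ContDiff ℝ ∞ (polyJet α f y j) := by
  unfold polyJet
  refine ContDiff.sum fun l _ => contDiff_const.mul ?_
  exact (contDiff_mono l).comp (contDiff_id.sub contDiff_const)

/-- The shift l ↦ l - e_i matches the terms with l_i ≠ 0 on the left with those satisfying |l| + 1 ≤
α on the right. The other terms vanish, on the left because the monomial is constant in z_i and on
the right by truncation. -/
theorem sum_mul_monoPartial (α : ℝ) (f : Jet n) (y : Eucl n) (j : Fin n → ℕ) (i : Fin n)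
    (z : Eucl n) :
    ∑ l ∈ indices n α, trunc α f (j + l) y * monoPartial l i z =
      ∑ l ∈ indices n α, trunc α f (j + Pi.single i 1 + l) y * mono l z := by
  rw [← Finset.sum_filter_of_ne (p := fun l : Fin n → ℕ => l i ≠ 0)]
  swap
  · intro l _ h hl
    exact h (by simp [monoPartial, hl])
  refine Eq.trans ?_ (Finset.sum_filter_of_ne (p := fun l : Fin n → ℕ => (len l : ℝ) + 1 ≤ α) ?_)
  swap
  · intro l _ h
    by_contra hl
    refine h ?_
    rw [trunc_of_lt, Pi.zero_apply, zero_mul]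
    rw [len_add, len_add, len_single]
    push_cast
    have : (0 : ℝ) ≤ len j := Nat.cast_nonneg _
    linarith
  have key : ∀ l : Fin n → ℕ, l i ≠ 0 → l - Pi.single i 1 + Pi.single i 1 = l := fun l hl => by
    ext k
    by_cases hk : k = i
    · subst hk
      simp
      omega
    · simp [hk]
  refine Finset.sum_bij' (fun l _ => l - Pi.single i 1) (fun l _ => l + Pi.single i 1) ?_ ?_ ?_ ?_ ?_
  · intro l hl
    rw [Finset.mem_filter, mem_indices] at hl
    have h2 := congrArg len (key l hl.2)
    rw [len_add, len_single] at h2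
    have h3 : (len (l - Pi.single i 1) : ℝ) + 1 = len l := by exact_mod_cast h2
    rw [Finset.mem_filter, mem_indices]
    constructor <;> linarith
  · intro l hl
    rw [Finset.mem_filter, mem_indices] at hl
    rw [Finset.mem_filter, mem_indices, len_add, len_single]
    push_cast
    exact ⟨hl.2, by simp⟩
  · intro l hl
    exact key l (Finset.mem_filter.1 hl).2
  · intro l _
    simp
  · intro l hl
    have hl' := (Finset.mem_filter.1 hl).2
    rw [monoPartial, if_neg hl', add_assoc, add_comm (Pi.single i 1), key l hl']

theorem isDerivFamily_polyJet (α : ℝ) (f : Jet n) (y : Eucl n) (m : ℕ) (U : Set (Eucl n)) :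
    IsDerivFamily m U (polyJet α f y) := by
  intro j _ z _
  have h : ∀ l ∈ indices n α, HasFDerivAt (fun x => trunc α f (j + l) y * mono l (x - y))
      (trunc α f (j + l) y • ∑ i, monoPartial l i (z - y) •
        (EuclideanSpace.proj i : Eucl n →L[ℝ] ℝ)) z := fun l _ =>
    ((hasFDerivAt_mono l (z - y)).comp z ((hasFDerivAt_id z).sub_const y)).const_mul _
  refine (HasFDerivAt.fun_sum h).congr_fderiv ?_
  simp only [Finset.smul_sum, smul_smul]
  rw [Finset.sum_comm]
  refine Finset.sum_congr rfl fun i _ => ?_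
  rw [← Finset.sum_smul, sum_mul_monoPartial]
  rfl

theorem multiDeriv_taylor (α : ℝ) (f : Jet n) (y : Eucl n) (j : Fin n → ℕ) (x : Eucl n) :
    multiDeriv j (taylor α f y) x = polyJet α f y j x := by
  have h := (isDerivFamily_polyJet α f y (len j) Set.univ).multiDeriv_eqOn isOpen_univ le_rfl
    (Set.mem_univ x)
  rwa [show taylor α f y = polyJet α f y 0 from funext (taylor_eq_polyJet α f y)]

theorem remainder_eq (α : ℝ) (f : Jet n) (j : Fin n → ℕ) (y x : Eucl n) :
    remainder α f j y x = f j x - polyJet α f y j x := by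
  rw [remainder, multiDeriv_taylor]

/-! ### Taylor's inequality -/

theorem norm_sum_smul_proj_le {c : Fin n → ℝ} {B : ℝ} (h : ∀ i, |c i| ≤ B) :
    ‖∑ i, c i • (EuclideanSpace.proj i : Eucl n →L[ℝ] ℝ)‖ ≤ n * B := by
  have hp : ∀ i : Fin n, ‖(EuclideanSpace.proj i : Eucl n →L[ℝ] ℝ)‖ ≤ 1 := fun i =>
    ContinuousLinearMap.opNorm_le_bound _ zero_le_one fun x => by
      simpa using PiLp.norm_apply_le x i
  calc ‖∑ i, c i • (EuclideanSpace.proj i : Eucl n →L[ℝ] ℝ)‖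
      ≤ ∑ i : Fin n, B := norm_sum_le_of_le _ fun i _ => by
        rw [norm_smul, Real.norm_eq_abs]
        exact (mul_le_of_le_one_right (abs_nonneg _) (hp i)).trans (h i)
    _ = n * B := by simp

/-- Descending induction on the order, with p = m - |j|: a bound for the first partials of F_j and
the mean value inequality give one more power of |z - y| and one more factor n. -/
theorem IsDerivFamily.abs_le_of_vanishing {m : ℕ} {S : Set (Eucl n)} (hS : Convex ℝ S) {F : Jet n}
    (hF : IsDerivFamily m S F) {y : Eucl n} (hy : y ∈ S) {M : ℝ}
    (h0 : ∀ j, len j < m → F j y = 0) (hM : ∀ j, len j = m → ∀ z ∈ S, |F j z| ≤ M) (p : ℕ) :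
    ∀ j, len j + p = m → ∀ z ∈ S, |F j z| ≤ (n : ℝ) ^ p * M * ‖z - y‖ ^ p := by
  induction p with
  | zero => intro j hj z hz; simpa using hM j (by omega) z hz
  | succ p ih =>
    intro j hj z hz
    have hjm : len j < m := by omega
    -- Intersecting with the ball keeps the set convex and ensures |w - y| ≤ |z - y| where the
    -- gradient is estimated.
    have hzS : z ∈ S ∩ Metric.closedBall y ‖z - y‖ := ⟨hz, by simp [dist_eq_norm]⟩
    have hyS : y ∈ S ∩ Metric.closedBall y ‖z - y‖ := ⟨hy, by simp⟩
    have key := (hS.inter (convex_closedBall y ‖z - y‖)).norm_image_sub_le_of_norm_hasFDerivWithin_le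
      (f := F j) (C := n * ((n : ℝ) ^ p * M * ‖z - y‖ ^ p))
      (fun w hw => (hF j hjm w hw.1).hasFDerivWithinAt) (fun w hw => ?_) hyS hzS
    · rw [h0 j hjm, sub_zero, Real.norm_eq_abs] at key
      refine key.trans_eq ?_
      ring
    · refine norm_sum_smul_proj_le fun i => ?_
      have h1 := ih (j + Pi.single i 1) (by rw [len_add, len_single]; omega) w hw.1
      have h2 : ‖w - y‖ ≤ ‖z - y‖ := by simpa [dist_eq_norm] using hw.2
      have hM0 : 0 ≤ (n : ℝ) ^ p * M := by
        have hl : len (j + Pi.single i (p + 1)) = m := by rw [len_add, len_single]; omega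
        have := (abs_nonneg _).trans (hM _ hl y hy)
        positivity
      exact h1.trans (by gcongr)

theorem lt_floor_add_one_iff {α : ℝ} (hα : 0 ≤ α) (k : ℕ) : k < ⌊α⌋₊ + 1 ↔ (k : ℝ) ≤ α := by
  rw [Nat.lt_succ_iff, Nat.le_floor_iff hα]

theorem IsDerivFamily.abs_sub_polyJet_le {α : ℝ} (hα : 0 ≤ α) {S : Set (Eucl n)} (hS : Convex ℝ S)
    {F : Jet n} (hF : IsDerivFamily (⌊α⌋₊ + 1) S F) {y : Eucl n} (hy : y ∈ S) {M : ℝ}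
    (hM : ∀ j, len j = ⌊α⌋₊ + 1 → ∀ z ∈ S, |F j z| ≤ M) {j : Fin n → ℕ} {p : ℕ}
    (hp : len j + p = ⌊α⌋₊ + 1) {z : Eucl n} (hz : z ∈ S) :
    |F j z - polyJet α F y j z| ≤ (n : ℝ) ^ p * M * ‖z - y‖ ^ p := by
  refine (hF.sub (isDerivFamily_polyJet α F y _ S)).abs_le_of_vanishing hS hy ?_ ?_ p j hp z hz
  · intro k hk
    rw [polyJet_self hα, trunc_of_le ((lt_floor_add_one_iff hα _).1 hk), sub_self]
  · intro k hk w hw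
    rw [polyJet_of_lt, sub_zero]
    · exact hM k hk w hw
    · rw [hk]; exact_mod_cast Nat.lt_floor_add_one α

/-- Re-expansion of a Taylor polynomial at another point. -/
theorem polyJet_eq_sum {α : ℝ} (hα : 0 ≤ α) (f : Jet n) (y w z : Eucl n) (j : Fin n → ℕ) :
    polyJet α f y j z = ∑ l ∈ indices n α, polyJet α f y (j + l) w * mono l (z - w) := by
  by_cases hj : (len j : ℝ) ≤ α
  · have hj' := (lt_floor_add_one_iff hα _).2 hj
    -- Derivatives of order ⌊α⌋ + 1 of the polynomial vanish, so Taylor's inequality with M = 0 is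
    -- an identity.
    have h := (isDerivFamily_polyJet α f y (⌊α⌋₊ + 1) Set.univ).abs_sub_polyJet_le hα convex_univ
      (Set.mem_univ w) (M := 0) (fun k hk u _ => by
        rw [polyJet_of_lt, abs_zero]; rw [hk]; exact_mod_cast Nat.lt_floor_add_one α)
      (j := j) (p := ⌊α⌋₊ + 1 - len j) (by omega) (Set.mem_univ z)
    rw [mul_zero, zero_mul, abs_nonpos_iff, sub_eq_zero] at h
    rw [h]
    refine Finset.sum_congr rfl fun l _ => ?_
    by_cases hl : (len (j + l) : ℝ) ≤ α
    · rw [trunc_of_le hl]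
    · rw [trunc_of_lt (not_le.1 hl), polyJet_of_lt (not_le.1 hl), Pi.zero_apply]
  · rw [not_le] at hj
    rw [polyJet_of_lt hj]
    refine (Finset.sum_eq_zero fun l _ => ?_).symm
    rw [polyJet_of_lt, zero_mul]
    rw [len_add]
    push_cast
    have : (0 : ℝ) ≤ len l := Nat.cast_nonneg _
    linarith

/-! ### Iterated partial derivatives of smooth functions -/

theorem partialDeriv_eqOn_fderiv {U : Set (Eucl n)} (hU : IsOpen U) {F : Eucl n → ℝ}
    (hF : ContDiffOn ℝ ∞ F U) (i : Fin n) :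
    Set.EqOn (partialDeriv i F) (fun x => fderiv ℝ F x (EuclideanSpace.single i 1)) U := fun x hx =>
  partialDeriv_eq_of_hasFDerivAt
    ((hF.differentiableOn (by simp)).differentiableAt (hU.mem_nhds hx)).hasFDerivAt i

theorem contDiffOn_fderiv_apply {U : Set (Eucl n)} (hU : IsOpen U) {F : Eucl n → ℝ}
    (hF : ContDiffOn ℝ ∞ F U) (v : Eucl n) :
    ContDiffOn ℝ ∞ (fun x => fderiv ℝ F x v) U :=
  (hF.fderiv_of_isOpen hU (by simp)).clm_apply contDiffOn_const

theorem contDiffOn_partialDeriv {U : Set (Eucl n)} (hU : IsOpen U) {F : Eucl n → ℝ}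
    (hF : ContDiffOn ℝ ∞ F U) (i : Fin n) : ContDiffOn ℝ ∞ (partialDeriv i F) U :=
  (contDiffOn_fderiv_apply hU hF _).congr (partialDeriv_eqOn_fderiv hU hF i)

theorem partialDeriv_comm {U : Set (Eucl n)} (hU : IsOpen U) {F : Eucl n → ℝ}
    (hF : ContDiffOn ℝ ∞ F U) (i k : Fin n) :
    Set.EqOn (partialDeriv i (partialDeriv k F)) (partialDeriv k (partialDeriv i F)) U := by
  have key : ∀ i k : Fin n, Set.EqOn (partialDeriv i (partialDeriv k F)) (fun x =>
      fderiv ℝ (fderiv ℝ F) x (EuclideanSpace.single i 1) (EuclideanSpace.single k 1)) U := by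
    intro i k x hx
    rw [partialDeriv_congr hU (partialDeriv_eqOn_fderiv hU hF k) i hx]
    have hd : DifferentiableAt ℝ (fderiv ℝ F) x :=
      ((hF.fderiv_of_isOpen hU (m := ∞) (by simp)).differentiableOn
        (by simp)).differentiableAt (hU.mem_nhds hx)
    rw [partialDeriv_eq_of_hasFDerivAt
      (hd.hasFDerivAt.clm_apply (hasFDerivAt_const (EuclideanSpace.single k (1 : ℝ)) x)) i]
    simp
  intro x hx
  rw [key i k hx, key k i hx]
  exact (hF.contDiffAt (hU.mem_nhds hx)).isSymmSndFDerivAt (by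
    rw [minSmoothness_of_isRCLikeNormedField]
    exact WithTop.coe_le_coe.2 (le_top : (2 : ℕ∞) ≤ ⊤)) _ _

/-- The iterated partial derivative along a list of directions. -/
def listDeriv (L : List (Fin n)) (F : Eucl n → ℝ) : Eucl n → ℝ := L.foldr partialDeriv F

theorem contDiffOn_listDeriv {U : Set (Eucl n)} (hU : IsOpen U) {F : Eucl n → ℝ}
    (hF : ContDiffOn ℝ ∞ F U) (L : List (Fin n)) : ContDiffOn ℝ ∞ (listDeriv L F) U := by
  induction L with
  | nil => exact hF
  | cons i L ih => exact contDiffOn_partialDeriv hU ih i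

theorem listDeriv_perm {U : Set (Eucl n)} (hU : IsOpen U) {F : Eucl n → ℝ}
    (hF : ContDiffOn ℝ ∞ F U) {L L' : List (Fin n)} (h : L.Perm L') :
    Set.EqOn (listDeriv L F) (listDeriv L' F) U := by
  induction h with
  | nil => exact Set.eqOn_refl _ _
  | cons i _ ih => exact partialDeriv_congr hU ih i
  | swap i k L => exact partialDeriv_comm hU (contDiffOn_listDeriv hU hF L) k i
  | trans _ _ ih₁ ih₂ => exact ih₁.trans ih₂

/-- The directions of `D^j`, listed with multiplicity. -/
def directions (j : Fin n → ℕ) : List (Fin n) :=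
  (List.finRange n).flatMap fun i => List.replicate (j i) i

theorem multiDeriv_eq_listDeriv (j : Fin n → ℕ) (F : Eucl n → ℝ) :
    multiDeriv j F = listDeriv (directions j) F := by
  unfold multiDeriv directions
  induction List.finRange n with
  | nil => rfl
  | cons i L ih =>
    rw [List.foldr_cons, ih, List.flatMap_cons, listDeriv, listDeriv, List.foldr_append]
    generalize List.foldr partialDeriv F _ = H
    induction j i with
    | zero => rfl
    | succ p ihp => rw [Function.iterate_succ_apply', ihp, List.replicate_succ, List.foldr_cons]

theorem count_directions (j : Fin n → ℕ) (i : Fin n) : (directions j).count i = j i := by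
  rw [directions, List.count_flatMap, ← Fin.sum_univ_def]
  simp [List.count_replicate]

theorem length_directions (j : Fin n → ℕ) : (directions j).length = len j := by
  rw [directions, List.length_flatMap, ← Fin.sum_univ_def, len]
  simp

theorem directions_add_single (j : Fin n → ℕ) (i : Fin n) :
    (directions (j + Pi.single i 1)).Perm (i :: directions j) := by
  rw [List.perm_iff_count]
  intro k
  rw [count_directions, List.count_cons, count_directions, Pi.add_apply, Pi.single_apply]
  by_cases h : k = i
  · simp [h]
  · simp [h, Ne.symm h]

/-- Differentiating `multiDeriv j F` puts the new direction in front, whereas `multiDeriv` of j +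
e_i has it at its place in the fixed order; the two agree by symmetry of mixed derivatives. -/
theorem isDerivFamily_multiDeriv {U : Set (Eucl n)} (hU : IsOpen U) {F : Eucl n → ℝ}
    (hF : ContDiffOn ℝ ∞ F U) (m : ℕ) : IsDerivFamily m U fun j => multiDeriv j F := by
  intro j _ z hz
  have hj : ContDiffOn ℝ ∞ (multiDeriv j F) U := by
    rw [multiDeriv_eq_listDeriv]
    exact contDiffOn_listDeriv hU hF _
  have hd := ((hj.differentiableOn (by simp)).differentiableAt (hU.mem_nhds hz)).hasFDerivAt
  refine hd.congr_fderiv ?_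
  refine ContinuousLinearMap.coe_injective ((EuclideanSpace.basisFun (Fin n) ℝ).toBasis.ext fun i => ?_)
  simp only [OrthonormalBasis.coe_toBasis, EuclideanSpace.basisFun_apply,
    ContinuousLinearMap.coe_coe]
  rw [sum_smul_proj_single, ← partialDeriv_eq_of_hasFDerivAt hd i]
  simp only [multiDeriv_eq_listDeriv]
  exact (listDeriv_perm hU hF (directions_add_single j i) hz).symm

/-- The vectors do not depend on F, so the identity can be used for two functions and subtracted;
this turns operator norm estimates of a difference into estimates of partial derivatives. -/
theorem exists_listDeriv_eq_iteratedFDeriv {U : Set (Eucl n)} (hU : IsOpen U) (L : List (Fin n)) :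
    ∃ v : Fin L.length → Eucl n, (∀ i, ‖v i‖ ≤ 1) ∧ ∀ F : Eucl n → ℝ, ContDiffOn ℝ ∞ F U →
      ∀ x ∈ U, listDeriv L F x = iteratedFDeriv ℝ L.length F x v := by
  induction L with
  | nil => exact ⟨fun _ => 0, by simp, fun F _ x _ => by simp [listDeriv]⟩
  | cons i L ih =>
    obtain ⟨v, hv, h⟩ := ih
    refine ⟨Fin.cons (EuclideanSpace.single i 1) v, fun k => ?_, fun F hF x hx => ?_⟩
    · refine Fin.cases ?_ (fun k => ?_) k
      · simp
      · simpa using hv k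
    · have hd : DifferentiableAt ℝ (iteratedFDeriv ℝ L.length F) x :=
        (hF.contDiffAt (hU.mem_nhds hx)).differentiableAt_iteratedFDeriv
          (by exact_mod_cast ENat.natCast_lt_top _)
      have h1 : Set.EqOn (listDeriv L F) (fun x => iteratedFDeriv ℝ L.length F x v) U :=
        fun x hx => h F hF x hx
      have h2 : HasFDerivAt (fun x => iteratedFDeriv ℝ L.length F x v)
          ((ContinuousMultilinearMap.apply ℝ (fun _ : Fin L.length => Eucl n) ℝ v).comp
            (fderiv ℝ (iteratedFDeriv ℝ L.length F) x)) x :=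
        (ContinuousMultilinearMap.apply ℝ (fun _ : Fin L.length => Eucl n) ℝ v).hasFDerivAt.comp x
          hd.hasFDerivAt
      change partialDeriv i (listDeriv L F) x = iteratedFDeriv ℝ (L.length + 1) F x _
      rw [partialDeriv_congr hU h1 i hx, partialDeriv_eq_of_hasFDerivAt h2 i,
        iteratedFDeriv_succ_apply_left]
      simp

theorem abs_multiDeriv_sub_le {U : Set (Eucl n)} (hU : IsOpen U) {F G : Eucl n → ℝ}
    (hF : ContDiffOn ℝ ∞ F U) (hG : ContDiffOn ℝ ∞ G U) (j : Fin n → ℕ) {x : Eucl n} (hx : x ∈ U) :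
    |multiDeriv j F x - multiDeriv j G x| ≤
      ‖iteratedFDeriv ℝ (len j) (fun z => F z - G z) x‖ := by
  rw [multiDeriv_eq_listDeriv, multiDeriv_eq_listDeriv, ← length_directions]
  obtain ⟨v, hv, h⟩ := exists_listDeriv_eq_iteratedFDeriv hU (directions j)
  have hle : ((directions j).length : ℕ∞ω) ≤ (∞ : ℕ∞ω) := by exact_mod_cast le_top
  have hsub := iteratedFDeriv_sub_apply ((hF.contDiffAt (hU.mem_nhds hx)).of_le hle)
    ((hG.contDiffAt (hU.mem_nhds hx)).of_le hle)
  rw [h F hF x hx, h G hG x hx, ← sub_apply, ← hsub, ← Real.norm_eq_abs]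
  refine (ContinuousMultilinearMap.le_opNorm _ _).trans ?_
  refine mul_le_of_le_one_right (norm_nonneg _) ?_
  exact Finset.prod_le_one (fun _ _ => norm_nonneg _) fun i _ => hv i

/-! ### Smooth kernels integrated over a compact set -/

section Kernel

variable {V : Type} [NormedAddCommGroup V] [NormedSpace ℝ V]

/-- The function `x ↦ ∫_E c(y) K(x - y) dμ(y)`. -/
def kernelInt (E : Set (Eucl n)) (μ : Measure (Eucl n)) (c : Eucl n → ℝ) (K : Eucl n → V)
    (x : Eucl n) : V :=
  ∫ y in E, c y • K (x - y) ∂μ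

theorem continuousOn_kernel {E : Set (Eucl n)} {c : Eucl n → ℝ} (hc : ContinuousOn c E)
    {K : Eucl n → V} (hK : ContinuousOn K {0}ᶜ) :
    ContinuousOn (fun p : Eucl n × Eucl n => c p.2 • K (p.1 - p.2)) (Eᶜ ×ˢ E) := by
  refine (hc.comp continuousOn_snd fun p hp => hp.2).smul
    (hK.comp (continuousOn_fst.sub continuousOn_snd) fun p hp => ?_)
  simp only [Set.mem_compl_iff, Set.mem_singleton_iff, sub_eq_zero]
  intro h
  exact hp.1 (h ▸ hp.2)

theorem continuousOn_kernel_right {E : Set (Eucl n)} {c : Eucl n → ℝ} (hc : ContinuousOn c E)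
    {K : Eucl n → V} (hK : ContinuousOn K {0}ᶜ) {x : Eucl n} (hx : x ∉ E) :
    ContinuousOn (fun y => c y • K (x - y)) E :=
  (continuousOn_kernel hc hK).comp (continuousOn_const.prodMk continuousOn_id)
    fun _ hy => ⟨hx, hy⟩

theorem integrableOn_kernel {E : Set (Eucl n)} (hE : IsCompact E) {μ : Measure (Eucl n)}
    [IsFiniteMeasure μ] {c : Eucl n → ℝ} (hc : ContinuousOn c E)
    {K : Eucl n → V} (hK : ContinuousOn K {0}ᶜ) {x : Eucl n} (hx : x ∉ E) :
    IntegrableOn (fun y => c y • K (x - y)) E μ :=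
  (continuousOn_kernel_right hc hK hx).integrableOn_compact hE

theorem hasFDerivAt_kernelInt {E : Set (Eucl n)} (hE : IsCompact E) {μ : Measure (Eucl n)}
    [IsFiniteMeasure μ] {c : Eucl n → ℝ} (hc : ContinuousOn c E)
    {K : Eucl n → V} (hK : ContDiffOn ℝ ∞ K {0}ᶜ) {x : Eucl n} (hx : x ∉ E) :
    HasFDerivAt (kernelInt E μ c K) (kernelInt E μ c (fderiv ℝ K) x) x := by
  have hK0 : ContinuousOn K {0}ᶜ := hK.continuousOn
  have hK1 : ContinuousOn (fderiv ℝ K) {0}ᶜ :=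
    hK.continuousOn_fderiv_of_isOpen isOpen_compl_singleton (by simp)
  obtain ⟨ε, hε, hball⟩ := Metric.nhds_basis_closedBall.mem_iff.1
    (hE.isClosed.isOpen_compl.mem_nhds hx)
  obtain ⟨B, hB⟩ := ((isCompact_closedBall x ε).prod hE).exists_bound_of_continuousOn
    ((continuousOn_kernel hc hK1).mono (Set.prod_mono_left hball))
  refine hasFDerivAt_integral_of_dominated_of_fderiv_le (s := Metric.closedBall x ε)
    (bound := fun _ => B) (F' := fun x y => c y • fderiv ℝ K (x - y))
    (Metric.closedBall_mem_nhds x hε) ?_ ?_ ?_ ?_ ?_ ?_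
  · filter_upwards [Metric.closedBall_mem_nhds x hε] with z hz
    exact (integrableOn_kernel hE hc hK0 (hball hz)).aestronglyMeasurable
  · exact integrableOn_kernel hE hc hK0 hx
  · exact (integrableOn_kernel hE hc hK1 hx).aestronglyMeasurable
  · filter_upwards [ae_restrict_mem hE.measurableSet] with y hy z hz
    exact hB (z, y) ⟨hz, hy⟩
  · exact integrable_const _
  · filter_upwards [ae_restrict_mem hE.measurableSet] with y hy z hz
    have hzy : z - y ∈ ({0}ᶜ : Set (Eucl n)) := by
      simp only [Set.mem_compl_iff, Set.mem_singleton_iff, sub_eq_zero]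
      rintro rfl
      exact hball hz hy
    have hd := ((hK.differentiableOn (by simp)).differentiableAt
      (isOpen_compl_singleton.mem_nhds hzy)).hasFDerivAt
    exact (hd.comp z ((hasFDerivAt_id z).sub_const y)).const_smul (c y)

theorem contDiffOn_kernelInt {E : Set (Eucl n)} (hE : IsCompact E) {μ : Measure (Eucl n)}
    [IsFiniteMeasure μ] {c : Eucl n → ℝ} (hc : ContinuousOn c E)
    {K : Eucl n → V} (hK : ContDiffOn ℝ ∞ K {0}ᶜ) : ContDiffOn ℝ ∞ (kernelInt E μ c K) Eᶜ := by
  rw [contDiffOn_infty]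
  intro m
  -- The derivative is an integral of the same type with kernel `fderiv ℝ K`, so the target space
  -- must vary.
  induction m generalizing V with
  | zero =>
    refine contDiffOn_zero.2 fun x hx => ?_
    exact (hasFDerivAt_kernelInt hE hc hK hx).continuousAt.continuousWithinAt
  | succ m ih =>
    push_cast
    rw [contDiffOn_succ_iff_fderiv_of_isOpen hE.isClosed.isOpen_compl]
    refine ⟨fun x hx => (hasFDerivAt_kernelInt hE hc hK hx).differentiableAt.differentiableWithinAt,
      by simp, ?_⟩
    exact (ih (hK.fderiv_of_isOpen isOpen_compl_singleton (by simp))).congr fun x hx =>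
      (hasFDerivAt_kernelInt hE hc hK hx).fderiv

theorem norm_iteratedFDeriv_kernelInt_le {E : Set (Eucl n)} (hE : IsCompact E)
    {μ : Measure (Eucl n)} [IsFiniteMeasure μ] {c : Eucl n → ℝ} (hc : ContinuousOn c E)
    {K : Eucl n → V} (hK : ContDiffOn ℝ ∞ K {0}ᶜ) (m : ℕ) {x : Eucl n} (hx : x ∉ E) :
    ‖iteratedFDeriv ℝ m (kernelInt E μ c K) x‖ ≤
      ∫ y in E, |c y| * ‖iteratedFDeriv ℝ m K (x - y)‖ ∂μ := by
  induction m generalizing V with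
  | zero =>
    simp only [norm_iteratedFDeriv_zero]
    refine (norm_integral_le_integral_norm _).trans_eq ?_
    simp only [norm_smul, Real.norm_eq_abs]
  | succ m ih =>
    simp only [← norm_iteratedFDeriv_fderiv]
    have h : fderiv ℝ (kernelInt E μ c K) =ᶠ[nhds x] kernelInt E μ c (fderiv ℝ K) := by
      filter_upwards [hE.isClosed.isOpen_compl.mem_nhds hx] with z hz
      exact (hasFDerivAt_kernelInt hE hc hK hz).fderiv
    rw [(h.iteratedFDeriv ℝ m).eq_of_nhds]
    exact ih (hK.fderiv_of_isOpen isOpen_compl_singleton (by simp))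

end Kernel

/-! ### Homogeneous kernels -/

/-- A continuous homogeneous function is controlled by its maximum on the unit sphere, and
differentiation lowers the degree of homogeneity by one. -/
theorem exists_norm_iteratedFDeriv_le_of_homogeneous {V : Type} [NormedAddCommGroup V]
    [NormedSpace ℝ V] {K : Eucl n → V} (hK : ContDiffOn ℝ ∞ K {0}ᶜ) {β : ℝ}
    (hh : ∀ t : ℝ, 0 < t → ∀ z, z ≠ 0 → K (t • z) = t ^ β • K z) (m : ℕ) :
    ∃ C : ℝ, 0 ≤ C ∧ ∀ z, z ≠ 0 → ‖iteratedFDeriv ℝ m K z‖ ≤ C * ‖z‖ ^ (β - m) := by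
  induction m generalizing V β with
  | zero =>
    obtain ⟨C, hC⟩ := (isCompact_sphere (0 : Eucl n) 1).exists_bound_of_continuousOn
      (hK.continuousOn.mono fun z hz => by
        rintro rfl
        simp at hz)
    refine ⟨max C 0, le_max_right _ _, fun z hz => ?_⟩
    have hz' : 0 < ‖z‖ := norm_pos_iff.2 hz
    have h1 : K z = ‖z‖ ^ β • K (‖z‖⁻¹ • z) := by
      rw [← hh _ hz' _ (smul_ne_zero (inv_ne_zero hz'.ne') hz), smul_smul,
        mul_inv_cancel₀ hz'.ne', one_smul]
    have h2 : ‖K (‖z‖⁻¹ • z)‖ ≤ C := hC _ (by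
      simp [norm_smul, inv_mul_cancel₀ hz'.ne'])
    rw [norm_iteratedFDeriv_zero, h1, norm_smul, Real.norm_of_nonneg (by positivity),
      Nat.cast_zero, sub_zero, mul_comm]
    gcongr
    exact h2.trans (le_max_left _ _)
  | succ m ih =>
    obtain ⟨C, hC0, hC⟩ := ih (hK.fderiv_of_isOpen isOpen_compl_singleton (by simp)) (β := β - 1) (by
      intro t ht z hz
      have hd : ∀ w : Eucl n, w ≠ 0 → HasFDerivAt K (fderiv ℝ K w) w := fun w hw =>
        ((hK.differentiableOn (by simp)).differentiableAt
          (isOpen_compl_singleton.mem_nhds hw)).hasFDerivAt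
      have h1 : HasFDerivAt (fun w => K (t • w))
          ((fderiv ℝ K (t • z)).comp (t • ContinuousLinearMap.id ℝ (Eucl n))) z :=
        (hd (t • z) (smul_ne_zero ht.ne' hz)).comp z ((hasFDerivAt_id z).const_smul t)
      have h2 : HasFDerivAt (fun w => K (t • w)) (t ^ β • fderiv ℝ K z) z := by
        refine ((hd z hz).const_smul (t ^ β)).congr_of_eventuallyEq ?_
        filter_upwards [isOpen_compl_singleton.mem_nhds hz] with w hw
        exact hh t ht w hw
      have h3 := h1.unique h2
      rw [ContinuousLinearMap.comp_smul, ContinuousLinearMap.comp_id] at h3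
      rw [Real.rpow_sub ht, Real.rpow_one, div_eq_inv_mul, ← smul_smul, ← h3, smul_smul,
        inv_mul_cancel₀ ht.ne', one_smul])
    refine ⟨C, hC0, fun z hz => ?_⟩
    rw [← norm_iteratedFDeriv_fderiv]
    refine (hC z hz).trans_eq ?_
    push_cast
    ring_nf

/-- The kernel `|z|^{-q} z^l / l!`. -/
def rieszMono (q : ℝ) (l : Fin n → ℕ) (z : Eucl n) : ℝ := ‖z‖ ^ (-q) * mono l z

theorem contDiffOn_rieszMono (q : ℝ) (l : Fin n → ℕ) :
    ContDiffOn ℝ ∞ (rieszMono q l : Eucl n → ℝ) {0}ᶜ := by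
  refine ContDiffOn.mul (fun z hz => ?_) (contDiff_mono l).contDiffOn
  exact (((contDiffAt_norm ℝ hz).rpow_const_of_ne (norm_ne_zero_iff.2 hz))).contDiffWithinAt

theorem rieszMono_smul (q : ℝ) (l : Fin n → ℕ) {t : ℝ} (ht : 0 < t) (z : Eucl n) :
    rieszMono q l (t • z) = t ^ (-q + len l) • rieszMono q l z := by
  rw [rieszMono, rieszMono, norm_smul, Real.norm_of_nonneg ht.le,
    Real.mul_rpow ht.le (norm_nonneg _), mono_smul, Real.rpow_add ht, Real.rpow_natCast, smul_eq_mul]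
  ring

theorem exists_norm_iteratedFDeriv_rieszMono_le (q : ℝ) (l : Fin n → ℕ) (m : ℕ) :
    ∃ C : ℝ, 0 ≤ C ∧ ∀ z : Eucl n, z ≠ 0 →
      ‖iteratedFDeriv ℝ m (rieszMono q l) z‖ ≤ C * ‖z‖ ^ (-q + len l - m) :=
  exists_norm_iteratedFDeriv_le_of_homogeneous (contDiffOn_rieszMono q l)
    (fun _ ht z _ => rieszMono_smul q l ht z) m

/-! ### Measures of polynomial growth -/

section Growth

variable {υ : ℝ} {E : Set (Eucl n)} {μ : Measure (Eucl n)}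

theorem MemU.nonempty (hμ : MemU υ E μ) : E.Nonempty := by
  have := hμ.prob
  rw [← hμ.supp]
  exact Measure.nonempty_support (IsProbabilityMeasure.ne_zero μ)

theorem MemU.restrict_eq (hμ : MemU υ E μ) : μ.restrict E = μ :=
  Measure.restrict_eq_self_of_ae_mem (by
    have h := Measure.support_mem_ae (μ := μ)
    rwa [hμ.supp] at h)

theorem MemU.ball_pos (hμ : MemU υ E μ) {a : Eucl n} (ha : a ∈ E) {r : ℝ} (hr : 0 < r) :
    0 < μ.real (Metric.ball a r) := by
  have := hμ.prob
  rw [← hμ.supp, Measure.mem_support_iff_forall] at ha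
  exact ENNReal.toReal_pos (ha _ (Metric.ball_mem_nhds a hr)).ne' (measure_ne_top _ _)

/-- With r = 1/k the growth condition gives μ(B(a, 1)) ≤ |C| k^υ, which for υ < 0 tends to 0 as k →
∞, although the left side is positive. -/
theorem MemU.exponent_nonneg (hμ : MemU υ E μ) : 0 ≤ υ := by
  have := hμ.prob
  by_contra hυ
  rw [not_le] at hυ
  obtain ⟨a, ha⟩ := hμ.nonempty
  obtain ⟨C, hC⟩ := hμ.growth
  have hlim : Filter.Tendsto (fun k : ℝ => |C| * k ^ υ) Filter.atTop (nhds 0) := by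
    simpa using (tendsto_rpow_neg_atTop (neg_pos.2 hυ)).const_mul |C|
  have hpos := hμ.ball_pos ha one_pos
  obtain ⟨k, hk, hk1⟩ :=
    ((hlim.eventually_lt_const hpos).and (Filter.eventually_gt_atTop 1)).exists
  have hk0 : 0 < k := one_pos.trans hk1
  have hkk : k * k⁻¹ = 1 := mul_inv_cancel₀ hk0.ne'
  have h := hC a ha k⁻¹ k (inv_pos.2 hk0) (by rw [hkk]; exact inv_lt_one_of_one_lt₀ hk1) hkk.le
  rw [hkk] at h
  refine absurd h (not_le.2 (lt_of_le_of_lt ?_ hk))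
  have h1 : μ.real (Metric.ball a k⁻¹) ≤ 1 := measureReal_le_one
  calc C * k ^ υ * μ.real (Metric.ball a k⁻¹) ≤ |C| * k ^ υ * μ.real (Metric.ball a k⁻¹) := by
        gcongr
        exact le_abs_self C
    _ ≤ |C| * k ^ υ := mul_le_of_le_one_right (by positivity) h1

theorem MemU.exists_le_unit_ball (hE : IsCompact E) (hμ : MemU υ E μ) :
    ∃ c : ℝ, 0 < c ∧ ∀ a ∈ E, c ≤ μ.real (Metric.ball a 1) := by
  have := hμ.prob
  obtain ⟨t, htE, hcov⟩ := hE.elim_nhds_subcover (fun a => Metric.ball a (1 / 2))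
    fun a _ => Metric.ball_mem_nhds a (by norm_num)
  have ht : t.Nonempty := by
    obtain ⟨a, ha⟩ := hμ.nonempty
    obtain ⟨b, hb, _⟩ := Set.mem_iUnion₂.1 (hcov ha)
    exact ⟨b, hb⟩
  obtain ⟨b, hb, hmin⟩ := t.exists_min_image (fun a => μ.real (Metric.ball a (1 / 2))) ht
  refine ⟨_, hμ.ball_pos (htE b hb) (by norm_num : (0 : ℝ) < 1 / 2), fun a ha => ?_⟩
  obtain ⟨b', hb', hab⟩ := Set.mem_iUnion₂.1 (hcov ha)
  refine (hmin b' hb').trans (measureReal_mono (Metric.ball_subset_ball' ?_))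
  rw [Metric.mem_ball, dist_comm] at hab
  linarith

/-- Removes the restriction k r ≤ 1. If k r > 1, the left side is at most 1, while growth from
radius r to radius 1, by the factor 1/r ≤ k, and the uniform lower bound c for unit balls bound the
right side below. -/
theorem MemU.exists_growth (hE : IsCompact E) (hμ : MemU υ E μ) :
    ∃ C : ℝ, 0 < C ∧ ∀ a ∈ E, ∀ r k : ℝ, 0 < r → r ≤ 1 → 1 ≤ k →
      μ.real (Metric.ball a (k * r)) ≤ C * k ^ υ * μ.real (Metric.ball a r) := by
  have := hμ.prob
  obtain ⟨C, hC⟩ := hμ.growth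
  obtain ⟨c, hc, hcE⟩ := hμ.exists_le_unit_ball hE
  have hυ := hμ.exponent_nonneg
  set A : ℝ := max C 1 with hA
  have hA1 : 1 ≤ A := le_max_right _ _
  have hA0 : 0 < A := one_pos.trans_le hA1
  have hgr : ∀ a ∈ E, ∀ r k : ℝ, 0 < r → 1 ≤ k → k * r ≤ 1 →
      μ.real (Metric.ball a (k * r)) ≤ A * k ^ υ * μ.real (Metric.ball a r) := by
    intro a ha r k hr hk hkr
    rcases hk.eq_or_lt with rfl | hk
    · rw [one_mul, Real.one_rpow, mul_one]
      exact le_mul_of_one_le_left measureReal_nonneg hA1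
    · refine (hC a ha r k hr (by nlinarith) hkr).trans ?_
      have : 0 ≤ k ^ υ := Real.rpow_nonneg (by linarith) _
      gcongr
      exact le_max_left _ _
  have hc1 : c ≤ 1 := by
    obtain ⟨a, ha⟩ := hμ.nonempty
    exact (hcE a ha).trans measureReal_le_one
  refine ⟨A / c, by positivity, fun a ha r k hr hr1 hk => ?_⟩
  have hk0 : 0 < k := one_pos.trans_le hk
  rcases le_or_gt (k * r) 1 with hkr | hkr
  · refine (hgr a ha r k hr hk hkr).trans ?_
    gcongr
    exact le_div_self hA0.le hc hc1
  · have h1 := hgr a ha r r⁻¹ hr (one_le_inv_iff₀.2 ⟨hr, hr1⟩) (inv_mul_cancel₀ hr.ne').le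
    rw [inv_mul_cancel₀ hr.ne'] at h1
    have h2 : r⁻¹ ^ υ ≤ k ^ υ := by
      refine Real.rpow_le_rpow (by positivity) ?_ hυ
      rw [inv_le_iff_one_le_mul₀ hr]
      exact hkr.le
    have h3 : c ≤ A * k ^ υ * μ.real (Metric.ball a r) := by
      refine (hcE a ha).trans (h1.trans ?_)
      gcongr
    calc μ.real (Metric.ball a (k * r)) ≤ 1 := measureReal_le_one
      _ ≤ A * k ^ υ * μ.real (Metric.ball a r) / c := (one_le_div hc).2 h3
      _ = A / c * k ^ υ * μ.real (Metric.ball a r) := by ring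

end Growth

/-! ### Riesz potentials of the measure -/

section Riesz

variable {υ : ℝ} {E : Set (Eucl n)} {μ : Measure (Eucl n)}

theorem exists_infDist_eq {x : Eucl n} (hE : IsCompact E) (hne : E.Nonempty) :
    ∃ a ∈ E, Metric.infDist x E = ‖x - a‖ := by
  obtain ⟨a, ha, h⟩ := hE.exists_infDist_eq_dist hne x
  exact ⟨a, ha, by rw [h, dist_eq_norm]⟩

theorem infDist_pos {x : Eucl n} (hE : IsCompact E) (hne : E.Nonempty) (hx : x ∉ E) :
    0 < Metric.infDist x E :=
  (hE.isClosed.notMem_iff_infDist_pos hne).1 hx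

theorem infDist_le_norm {x y : Eucl n} (hy : y ∈ E) : Metric.infDist x E ≤ ‖x - y‖ := by
  rw [← dist_eq_norm]
  exact Metric.infDist_le_dist_of_mem hy

theorem norm_sub_pos_of_notMem {x y : Eucl n} (hx : x ∉ E) (hy : y ∈ E) : 0 < ‖x - y‖ :=
  norm_pos_iff.2 (sub_ne_zero.2 fun h => hx (h ▸ hy))

theorem continuousOn_rpow_norm_sub (s : ℝ) {x : Eucl n} (hx : x ∉ E) :
    ContinuousOn (fun y => ‖x - y‖ ^ s) E :=
  (continuousOn_const.sub continuousOn_id).norm.rpow_const fun _ hy =>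
    Or.inl (norm_sub_pos_of_notMem hx hy).ne'

theorem integrableOn_rpow_norm_sub [IsFiniteMeasure μ] (hE : IsCompact E) (s : ℝ) {x : Eucl n}
    (hx : x ∉ E) : IntegrableOn (fun y => ‖x - y‖ ^ s) E μ :=
  (continuousOn_rpow_norm_sub s hx).integrableOn_compact hE

theorem hWeight_eq (q : ℝ) (x : Eucl n) : hWeight E μ q x = ∫ y in E, ‖x - y‖ ^ (-q) ∂μ := by
  simp only [hWeight, dist_eq_norm]

/-- A pointwise dyadic bound for the Riesz kernel. -/
theorem rpow_neg_le_sum_dyadic {s d t : ℝ} (hs : 0 ≤ s) (hd : 0 < d) (hdt : d ≤ t) {N : ℕ}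
    (hN : t < 2 ^ N * d) :
    t ^ (-s) ≤ ∑ k ∈ Finset.range N, if t < 2 ^ (k + 1) * d then ((2 : ℝ) ^ k * d) ^ (-s) else 0 := by
  classical
  have hex : ∃ k : ℕ, t < 2 ^ k * d := ⟨N, hN⟩
  -- The least such exponent K = k + 1 singles out the shell 2^k d ≤ t < 2^(k+1) d; its term alone
  -- dominates.
  set K := Nat.find hex with hK
  have hK1 : t < 2 ^ K * d := Nat.find_spec hex
  have hK0 : K ≠ 0 := by
    intro h
    rw [h] at hK1
    simp at hK1
    linarith
  obtain ⟨k, hk⟩ := Nat.exists_eq_succ_of_ne_zero hK0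
  have hkt : 2 ^ k * d ≤ t := not_lt.1 (Nat.find_min hex (by omega : k < K))
  have hkN : k ∈ Finset.range N := by
    have := Nat.find_min' hex hN
    rw [Finset.mem_range]
    omega
  calc t ^ (-s) ≤ ((2 : ℝ) ^ k * d) ^ (-s) :=
        Real.rpow_le_rpow_of_nonpos (by positivity) hkt (by linarith)
    _ = if t < 2 ^ (k + 1) * d then ((2 : ℝ) ^ k * d) ^ (-s) else 0 := by
        rw [if_pos]
        rw [hk] at hK1
        exact hK1
    _ ≤ _ := Finset.single_le_sum
        (f := fun k => if t < 2 ^ (k + 1) * d then ((2 : ℝ) ^ k * d) ^ (-s) else 0)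
        (fun k _ => by split_ifs <;> positivity) hkN

theorem sum_geometric_le {υ s : ℝ} (h : υ < s) (N : ℕ) :
    ∑ k ∈ Finset.range N, ((2 : ℝ) ^ (υ - s)) ^ k ≤ (1 - (2 : ℝ) ^ (υ - s))⁻¹ := by
  have h1 : (2 : ℝ) ^ (υ - s) < 1 := Real.rpow_lt_one_of_one_lt_of_neg one_lt_two (by linarith)
  rw [← tsum_geometric_of_lt_one (by positivity) h1]
  exact (summable_geometric_of_lt_one (by positivity) h1).sum_le_tsum _ fun _ _ => by positivity

/-- The shell |x - y| < 2^(k+1) d lies in B(a, 2^(k+1) · 2d), whose mass is at most a multiple of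
2^(υk) μ(B(a, 2d)); the growth bound needs 2d ≤ 1. The weight 2^(-sk) makes the sum geometric
because υ < s. -/
theorem MemU.exists_riesz_le_of_small (hE : IsCompact E) (hμ : MemU υ E μ) {s : ℝ} (hs : υ < s) :
    ∃ C : ℝ, 0 < C ∧ ∀ a ∈ E, ∀ x ∉ E, Metric.infDist x E = ‖x - a‖ → 2 * ‖x - a‖ ≤ 1 →
      ∫ y in E, ‖x - y‖ ^ (-s) ∂μ ≤ C * ‖x - a‖ ^ (-s) * μ.real (Metric.ball a (2 * ‖x - a‖)) := by
  have := hμ.prob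
  obtain ⟨C, hC0, hC⟩ := hμ.exists_growth hE
  have hυ := hμ.exponent_nonneg
  have hs0 : 0 ≤ s := hυ.trans hs.le
  have hgeo : (2 : ℝ) ^ (υ - s) < 1 := Real.rpow_lt_one_of_one_lt_of_neg one_lt_two (by linarith)
  have hgeo' : 0 < (1 - (2 : ℝ) ^ (υ - s))⁻¹ := inv_pos.2 (by linarith)
  refine ⟨C * 2 ^ υ * (1 - (2 : ℝ) ^ (υ - s))⁻¹, by positivity, fun a ha x hx hxa hsmall => ?_⟩
  set d := ‖x - a‖ with hd
  have hd0 : 0 < d := norm_sub_pos_of_notMem hx ha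
  obtain ⟨B, hB⟩ := hE.isBounded.exists_norm_le
  obtain ⟨N, hN⟩ := pow_unbounded_of_one_lt ((‖x‖ + B) / d) one_lt_two
  rw [div_lt_iff₀ hd0] at hN
  set V := μ.real (Metric.ball a (2 * d)) with hV
  have hpt : ∀ y ∈ E, ‖x - y‖ ^ (-s) ≤ ∑ k ∈ Finset.range N,
      (Metric.ball a ((2 : ℝ) ^ (k + 1) * (2 * d))).indicator
        (fun _ => ((2 : ℝ) ^ k * d) ^ (-s)) y := by
    intro y hy
    have hdy : d ≤ ‖x - y‖ := hxa ▸ infDist_le_norm hy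
    have hyN : ‖x - y‖ < 2 ^ N * d :=
      ((norm_sub_le x y).trans (by gcongr; exact hB y hy)).trans_lt hN
    refine (rpow_neg_le_sum_dyadic hs0 hd0 hdy hyN).trans (Finset.sum_le_sum fun k _ => ?_)
    split_ifs with hk
    · rw [Set.indicator_of_mem]
      rw [Metric.mem_ball, dist_eq_norm]
      have h2 : (1 : ℝ) ≤ 2 ^ (k + 1) := one_le_pow₀ one_le_two
      calc ‖y - a‖ = ‖(x - a) - (x - y)‖ := by congr 1; abel
        _ ≤ d + ‖x - y‖ := norm_sub_le _ _
        _ < 2 ^ (k + 1) * (2 * d) := by nlinarith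
    · exact Set.indicator_nonneg (fun _ _ => by positivity) _
  have hnint : ∀ k ∈ Finset.range N, Integrable
      ((Metric.ball a ((2 : ℝ) ^ (k + 1) * (2 * d))).indicator
        (fun _ => ((2 : ℝ) ^ k * d) ^ (-s))) (μ.restrict E) := fun k _ =>
    (integrable_const _).indicator measurableSet_ball
  calc ∫ y in E, ‖x - y‖ ^ (-s) ∂μ
      ≤ ∫ y in E, ∑ k ∈ Finset.range N, (Metric.ball a ((2 : ℝ) ^ (k + 1) * (2 * d))).indicator
        (fun _ => ((2 : ℝ) ^ k * d) ^ (-s)) y ∂μ :=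
        setIntegral_mono_on (integrableOn_rpow_norm_sub hE _ hx) (integrable_finsetSum _ hnint)
          hE.measurableSet hpt
    _ = ∑ k ∈ Finset.range N,
        μ.real (Metric.ball a ((2 : ℝ) ^ (k + 1) * (2 * d))) * ((2 : ℝ) ^ k * d) ^ (-s) := by
        rw [integral_finsetSum _ hnint]
        refine Finset.sum_congr rfl fun k _ => ?_
        rw [integral_indicator_const _ measurableSet_ball, hμ.restrict_eq, smul_eq_mul]
    _ ≤ ∑ k ∈ Finset.range N, C * 2 ^ υ * d ^ (-s) * V * ((2 : ℝ) ^ (υ - s)) ^ k := by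
        refine Finset.sum_le_sum fun k _ => ?_
        have h1 := hC a ha (2 * d) (2 ^ (k + 1)) (by positivity) hsmall (one_le_pow₀ one_le_two)
        refine (mul_le_mul_of_nonneg_right h1 (by positivity)).trans_eq ?_
        have e1 : ((2 : ℝ) ^ (k + 1)) ^ υ = 2 ^ υ * (2 ^ υ) ^ k := by
          rw [← Real.rpow_natCast, ← Real.rpow_mul zero_le_two, ← Real.rpow_natCast (2 ^ υ),
            ← Real.rpow_mul zero_le_two, ← Real.rpow_add two_pos]
          push_cast
          ring_nf
        have e2 : ((2 : ℝ) ^ k * d) ^ (-s) = (2 ^ (-s)) ^ k * d ^ (-s) := by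
          rw [Real.mul_rpow (by positivity) hd0.le, ← Real.rpow_natCast, ← Real.rpow_mul zero_le_two,
            ← Real.rpow_natCast (2 ^ (-s)), ← Real.rpow_mul zero_le_two, mul_comm (k : ℝ)]
        rw [e1, e2, sub_eq_add_neg, Real.rpow_add two_pos, mul_pow]
        ring
    _ = C * 2 ^ υ * d ^ (-s) * V * ∑ k ∈ Finset.range N, ((2 : ℝ) ^ (υ - s)) ^ k := by
        rw [Finset.mul_sum]
    _ ≤ C * 2 ^ υ * d ^ (-s) * V * (1 - (2 : ℝ) ^ (υ - s))⁻¹ := by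
        gcongr
        exact sum_geometric_le hs N
    _ = _ := by ring

/-- Keeping only the part of the integral over B(a, 2|x - a|), where |x - y| ≤ 3|x - a|, suffices.
-/
theorem MemU.hWeight_ge (hE : IsCompact E) (hμ : MemU υ E μ) {q : ℝ} (hq : 0 ≤ q) {a x : Eucl n}
    (hx : x ∉ E) :
    (3 * ‖x - a‖) ^ (-q) * μ.real (Metric.ball a (2 * ‖x - a‖)) ≤ hWeight E μ q x := by
  have := hμ.prob
  rw [hWeight_eq, mul_comm, ← smul_eq_mul, ← integral_indicator_const _ measurableSet_ball]
  nth_rw 1 [← hμ.restrict_eq]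
  refine setIntegral_mono_on ((integrable_const _).indicator measurableSet_ball)
    (integrableOn_rpow_norm_sub hE _ hx) hE.measurableSet fun y hy => ?_
  by_cases hyb : y ∈ Metric.ball a (2 * ‖x - a‖)
  · rw [Set.indicator_of_mem hyb]
    rw [Metric.mem_ball, dist_eq_norm, norm_sub_rev] at hyb
    refine Real.rpow_le_rpow_of_nonpos (norm_sub_pos_of_notMem hx hy) ?_ (by linarith)
    calc ‖x - y‖ = ‖(x - a) + (a - y)‖ := by congr 1; abel
      _ ≤ ‖x - a‖ + ‖a - y‖ := norm_add_le _ _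
      _ ≤ 3 * ‖x - a‖ := by linarith
  · rw [Set.indicator_of_notMem hyb]
    positivity

theorem MemU.hWeight_pos (hE : IsCompact E) (hμ : MemU υ E μ) {q : ℝ} (hq : 0 ≤ q) {x : Eucl n}
    (hx : x ∉ E) : 0 < hWeight E μ q x := by
  obtain ⟨a, ha⟩ := hμ.nonempty
  have hd := norm_sub_pos_of_notMem hx ha
  exact (mul_pos (by positivity) (hμ.ball_pos ha (by positivity))).trans_le (hμ.hWeight_ge hE hq (a := a) hx)

/-- The potential of order `q - α` is controlled by `d(x, E)^α` times that of order `q`. -/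
theorem MemU.exists_riesz_le (hE : IsCompact E) (hμ : MemU υ E μ) {α q : ℝ} (hα : 0 < α)
    (hq : υ + α < q) :
    ∃ C : ℝ, 0 < C ∧ ∀ x ∉ E,
      ∫ y in E, ‖x - y‖ ^ (α - q) ∂μ ≤ C * Metric.infDist x E ^ α * hWeight E μ q x := by
  have := hμ.prob
  have hυ := hμ.exponent_nonneg
  have hq0 : 0 ≤ q := by linarith
  obtain ⟨C, hC0, hC⟩ := hμ.exists_riesz_le_of_small hE (s := q - α) (by linarith)
  obtain ⟨D, hD0, hD⟩ : ∃ D : ℝ, 0 ≤ D ∧ ∀ y ∈ E, ∀ z ∈ E, ‖y - z‖ ≤ D := by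
    refine ⟨Metric.diam E, Metric.diam_nonneg, fun y hy z hz => ?_⟩
    rw [← dist_eq_norm]
    exact Metric.dist_le_diam_of_mem hE.isBounded hy hz
  refine ⟨max (C * 3 ^ q) ((1 + 2 * D) ^ α), lt_max_of_lt_left (by positivity), fun x hx => ?_⟩
  obtain ⟨a, ha, hxa⟩ := exists_infDist_eq (x := x) hE hμ.nonempty
  have hd0 : 0 < ‖x - a‖ := norm_sub_pos_of_notMem hx ha
  have hh0 := hμ.hWeight_pos hE hq0 hx
  rw [hxa]
  -- Near `E`, both potentials are compared with μ(B(a, 2d)). Far from `E`, the bound |x - y| ≤ d +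
  -- D ≤ (1 + 2D) d holds for all y in `E`, and the factor |x - y|^α comes out of the integral.
  rcases le_or_gt (2 * ‖x - a‖) 1 with hsmall | hlarge
  · have h1 := hC a ha x hx hxa hsmall
    rw [neg_sub] at h1
    have h2 := hμ.hWeight_ge hE hq0 (a := a) hx
    calc ∫ y in E, ‖x - y‖ ^ (α - q) ∂μ
        ≤ C * ‖x - a‖ ^ (α - q) * μ.real (Metric.ball a (2 * ‖x - a‖)) := h1
      _ = C * 3 ^ q * ‖x - a‖ ^ α *
          ((3 * ‖x - a‖) ^ (-q) * μ.real (Metric.ball a (2 * ‖x - a‖))) := by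
          rw [Real.mul_rpow (by norm_num) hd0.le, sub_eq_add_neg α q, Real.rpow_add hd0,
            Real.rpow_neg (by norm_num : (0 : ℝ) ≤ 3)]
          field_simp
      _ ≤ C * 3 ^ q * ‖x - a‖ ^ α * hWeight E μ q x := by gcongr
      _ ≤ _ := by gcongr; exact le_max_left _ _
  · calc ∫ y in E, ‖x - y‖ ^ (α - q) ∂μ
        ≤ ∫ y in E, (1 + 2 * D) ^ α * ‖x - a‖ ^ α * ‖x - y‖ ^ (-q) ∂μ := by
          refine setIntegral_mono_on (integrableOn_rpow_norm_sub hE _ hx)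
            ((integrableOn_rpow_norm_sub hE _ hx).const_mul _) hE.measurableSet fun y hy => ?_
          have hy0 := norm_sub_pos_of_notMem hx hy
          rw [sub_eq_add_neg α q, Real.rpow_add hy0, ← Real.mul_rpow (by positivity) hd0.le]
          gcongr
          calc ‖x - y‖ = ‖(x - a) + (a - y)‖ := by congr 1; abel
            _ ≤ ‖x - a‖ + ‖a - y‖ := norm_add_le _ _
            _ ≤ ‖x - a‖ + D := by gcongr; exact hD a ha y hy
            _ ≤ (1 + 2 * D) * ‖x - a‖ := by nlinarith
      _ = (1 + 2 * D) ^ α * ‖x - a‖ ^ α * hWeight E μ q x := by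
          rw [integral_const_mul, hWeight_eq]
      _ ≤ _ := by gcongr; exact le_max_right _ _

end Riesz

/-! ### Derivatives of reciprocals -/

theorem natCast_le_infty (m : ℕ) : (m : ℕ∞ω) ≤ (∞ : ℕ∞ω) := by exact_mod_cast le_top

/-- After division by h(x) the inner function equals 1 at x, so the bound for derivatives of a
composition involves t⁻¹ only at t = 1, and the constant depends only on m and A. In the application
δ is 1/d. -/
theorem exists_norm_iteratedFDeriv_inv_le (m : ℕ) {A : ℝ} (hA : 0 ≤ A) :
    ∃ C : ℝ, 0 ≤ C ∧ ∀ (U : Set (Eucl n)) (h : Eucl n → ℝ) (x : Eucl n) (δ : ℝ), IsOpen U →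
      ContDiffOn ℝ ∞ h U → (∀ z ∈ U, 0 < h z) → x ∈ U →
      (∀ i, 1 ≤ i → i ≤ m → ‖iteratedFDeriv ℝ i h x‖ ≤ (A * δ) ^ i * h x) →
      ‖iteratedFDeriv ℝ m (fun z => (h z)⁻¹) x‖ ≤ C * δ ^ m * (h x)⁻¹ := by
  set C₀ : ℝ := ∑ i ∈ Finset.range (m + 1),
    ‖iteratedFDerivWithin ℝ i (fun t : ℝ => t⁻¹) (Set.Ioi 0) 1‖ with hC₀
  have hC₀0 : 0 ≤ C₀ := Finset.sum_nonneg fun _ _ => norm_nonneg _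
  refine ⟨m.factorial * C₀ * A ^ m, by positivity, fun U h x δ hU hh hpos hx hD => ?_⟩
  have hx0 := hpos x hx
  have hu : ContDiffOn ℝ ∞ (fun z => (h x)⁻¹ • h z) U := hh.const_smul (h x)⁻¹
  have hinv : ContDiffOn ℝ ∞ (fun t : ℝ => t⁻¹) (Set.Ioi 0) :=
    contDiffOn_id.inv fun t ht => (Set.mem_Ioi.1 ht).ne'
  have key := norm_iteratedFDerivWithin_comp_le (g := fun t : ℝ => t⁻¹)
    (f := fun z => (h x)⁻¹ • h z) (n := m) (x := x) (C := C₀) (D := A * δ) hinv hu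
    (natCast_le_infty m) isOpen_Ioi.uniqueDiffOn hU.uniqueDiffOn
    (fun z hz => mul_pos (inv_pos.2 hx0) (hpos z hz)) hx (fun i hi => by
      rw [smul_eq_mul, inv_mul_cancel₀ hx0.ne']
      exact Finset.single_le_sum
        (f := fun i => ‖iteratedFDerivWithin ℝ i (fun t : ℝ => t⁻¹) (Set.Ioi 0) 1‖)
        (fun _ _ => norm_nonneg _) (Finset.mem_range.2 (Nat.lt_succ_of_le hi)))
    (fun i hi1 him => by
      rw [iteratedFDerivWithin_of_isOpen i hU hx, iteratedFDeriv_const_smul_apply'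
        ((hh.contDiffAt (hU.mem_nhds hx)).of_le (natCast_le_infty i)), norm_smul,
        Real.norm_of_nonneg (inv_pos.2 hx0).le, inv_mul_le_iff₀ hx0, mul_comm (h x)]
      exact hD i hi1 him)
  rw [iteratedFDerivWithin_of_isOpen m hU hx] at key
  have heq : (fun z => (h z)⁻¹) = fun z => (h x)⁻¹ • ((fun t : ℝ => t⁻¹) ∘ fun z => (h x)⁻¹ • h z) z := by
    funext z
    simp only [Function.comp_apply, smul_eq_mul, mul_inv, inv_inv]
    rw [inv_mul_cancel_left₀ hx0.ne']
  have hsm : ContDiffAt ℝ m ((fun t : ℝ => t⁻¹) ∘ fun z => (h x)⁻¹ • h z) x :=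
    ((hinv.comp hu fun z hz => mul_pos (inv_pos.2 hx0) (hpos z hz)).contDiffAt
      (hU.mem_nhds hx)).of_le (natCast_le_infty m)
  rw [heq, iteratedFDeriv_const_smul_apply' hsm, norm_smul, Real.norm_of_nonneg (inv_pos.2 hx0).le,
    mul_comm]
  gcongr
  refine key.trans_eq ?_
  ring

/-! ### Derivatives of the extension operator -/

section Extension

variable {υ α q : ℝ} {E : Set (Eucl n)} {μ : Measure (Eucl n)} {f : Jet n}

/-- Used with γ = 0 for the weight h_q and with γ = α for the remainders. The constant does not
depend on c, which in the second case varies with the nearest point. -/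
theorem exists_norm_iteratedFDeriv_kernelInt_rieszMono_le (hE : IsCompact E) [IsFiniteMeasure μ]
    (q γ : ℝ) (l : Fin n → ℕ) (m : ℕ) :
    ∃ C : ℝ, 0 ≤ C ∧ ∀ (c : Eucl n → ℝ) (B : ℝ) (x : Eucl n), ContinuousOn c E → x ∉ E → E.Nonempty →
      (∀ y ∈ E, |c y| ≤ B * ‖x - y‖ ^ (γ - len l)) →
      ‖iteratedFDeriv ℝ m (kernelInt E μ c (rieszMono q l)) x‖ ≤
        C * B * (Metric.infDist x E)⁻¹ ^ m * ∫ y in E, ‖x - y‖ ^ (γ - q) ∂μ := by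
  obtain ⟨C, hC0, hC⟩ := exists_norm_iteratedFDeriv_rieszMono_le q l m
  refine ⟨C, hC0, fun c B x hc hx hne hB => ?_⟩
  have hd0 := infDist_pos hE hne hx
  refine (norm_iteratedFDeriv_kernelInt_le hE hc (contDiffOn_rieszMono q l) m hx).trans ?_
  rw [← integral_const_mul]
  have hcont : ContinuousOn (fun y => |c y| * ‖iteratedFDeriv ℝ m (rieszMono q l) (x - y)‖) E := by
    refine hc.abs.mul (ContinuousOn.norm ?_)
    have h1 : ContinuousOn (iteratedFDeriv ℝ m (rieszMono q l)) ({0}ᶜ : Set (Eucl n)) :=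
      ((contDiffOn_rieszMono q l).continuousOn_iteratedFDerivWithin (natCast_le_infty m)
        isOpen_compl_singleton.uniqueDiffOn).congr fun z hz =>
          (iteratedFDerivWithin_of_isOpen m isOpen_compl_singleton hz).symm
    exact h1.comp (continuousOn_const.sub continuousOn_id) fun y hy =>
      norm_pos_iff.1 (norm_sub_pos_of_notMem hx hy)
  refine setIntegral_mono_on (hcont.integrableOn_compact hE)
    ((integrableOn_rpow_norm_sub hE _ hx).const_mul _) hE.measurableSet fun y hy => ?_
  have hy0 := norm_sub_pos_of_notMem hx hy
  have hle : (‖x - y‖⁻¹) ^ m ≤ (Metric.infDist x E)⁻¹ ^ m := by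
    gcongr
    exact infDist_le_norm hy
  have hB0 : 0 ≤ B := nonneg_of_mul_nonneg_left ((abs_nonneg _).trans (hB y hy)) (by positivity)
  calc |c y| * ‖iteratedFDeriv ℝ m (rieszMono q l) (x - y)‖
      ≤ (B * ‖x - y‖ ^ (γ - len l)) * (C * ‖x - y‖ ^ (-q + len l - m)) := by
        gcongr
        · exact hB y hy
        · exact hC _ (norm_pos_iff.1 hy0)
    _ = C * B * (‖x - y‖⁻¹) ^ m * ‖x - y‖ ^ (γ - q) := by
        have e : ‖x - y‖ ^ (γ - len l) * ‖x - y‖ ^ (-q + len l - m) =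
            (‖x - y‖⁻¹) ^ m * ‖x - y‖ ^ (γ - q) := by
          rw [inv_pow, ← Real.rpow_natCast, ← Real.rpow_neg hy0.le, ← Real.rpow_add hy0,
            ← Real.rpow_add hy0]
          ring_nf
        linear_combination C * B * e
    _ ≤ C * B * (Metric.infDist x E)⁻¹ ^ m * ‖x - y‖ ^ (γ - q) := by gcongr

theorem hWeight_eq_kernelInt (q : ℝ) :
    hWeight E μ q = kernelInt E μ (fun _ => 1) (rieszMono q 0) := by
  funext x
  rw [hWeight_eq, kernelInt]
  simp [rieszMono, mono_zero]

theorem contDiffOn_hWeight (hE : IsCompact E) [IsFiniteMeasure μ] (q : ℝ) :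
    ContDiffOn ℝ ∞ (hWeight E μ q) Eᶜ := by
  rw [hWeight_eq_kernelInt]
  exact contDiffOn_kernelInt hE continuousOn_const (contDiffOn_rieszMono q 0)

theorem MemU.exists_norm_iteratedFDeriv_inv_hWeight_le (hE : IsCompact E) (hμ : MemU υ E μ)
    (hq : 0 ≤ q) (m : ℕ) :
    ∃ C : ℝ, 0 ≤ C ∧ ∀ x ∉ E, ‖iteratedFDeriv ℝ m (fun z => (hWeight E μ q z)⁻¹) x‖ ≤
      C * (Metric.infDist x E)⁻¹ ^ m * (hWeight E μ q x)⁻¹ := by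
  have := hμ.prob
  choose B hB0 hB using fun i : ℕ =>
    exists_norm_iteratedFDeriv_kernelInt_rieszMono_le (μ := μ) hE q 0 0 i
  -- With A ≥ 1 and A ≥ B i, each constant B i with i ≥ 1 is absorbed in A ^ i.
  set A : ℝ := 1 + ∑ i ∈ Finset.range (m + 1), B i with hA
  have hA1 : 1 ≤ A := le_add_of_nonneg_right (Finset.sum_nonneg fun i _ => hB0 i)
  obtain ⟨C, hC0, hC⟩ := exists_norm_iteratedFDeriv_inv_le (n := n) m (zero_le_one.trans hA1)
  refine ⟨C, hC0, fun x hx => ?_⟩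
  refine hC Eᶜ _ x _ hE.isClosed.isOpen_compl (contDiffOn_hWeight hE q)
    (fun z hz => hμ.hWeight_pos hE hq hz) hx fun i hi1 him => ?_
  have h1 := hB i (fun _ => 1) 1 x continuousOn_const hx hμ.nonempty (by simp)
  rw [← hWeight_eq_kernelInt, zero_sub, ← hWeight_eq] at h1
  refine h1.trans ?_
  have hBA : B i ≤ A ^ i := by
    have h2 : B i ≤ A := by
      refine (Finset.single_le_sum (fun i _ => hB0 i)
        (Finset.mem_range.2 (Nat.lt_succ_of_le him))).trans ?_
      simp [hA]
    exact h2.trans (le_self_pow₀ hA1 (by omega))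
  have hpos := hμ.hWeight_pos hE hq hx
  have hd0 := infDist_pos hE hμ.nonempty hx
  rw [mul_one, mul_pow]
  gcongr

theorem sum_kernelInt_rieszMono (hE : IsCompact E) [IsFiniteMeasure μ] (q : ℝ)
    {s : Finset (Fin n → ℕ)} {c : (Fin n → ℕ) → Eucl n → ℝ} (hc : ∀ l ∈ s, ContinuousOn (c l) E)
    {x : Eucl n} (hx : x ∉ E) :
    ∑ l ∈ s, kernelInt E μ (c l) (rieszMono q l) x =
      ∫ y in E, ‖x - y‖ ^ (-q) * ∑ l ∈ s, c l y * mono l (x - y) ∂μ := by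
  simp only [kernelInt]
  rw [← integral_finsetSum _ fun l hl =>
    integrableOn_kernel hE (hc l hl) (contDiffOn_rieszMono q l).continuousOn hx]
  congr 1
  funext y
  rw [Finset.mul_sum]
  refine Finset.sum_congr rfl fun l _ => ?_
  rw [rieszMono, smul_eq_mul]
  ring

theorem extOp_eq_sum (hE : IsCompact E) [IsFiniteMeasure μ] (q : ℝ)
    (hf : ∀ j, (len j : ℝ) ≤ α → ContinuousOn (f j) E) {x : Eucl n} (hx : x ∉ E) :
    extOp E μ q α f x = (hWeight E μ q x)⁻¹ *
      ∑ l ∈ indices n α, kernelInt E μ (f l) (rieszMono q l) x := by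
  rw [extOp, sum_kernelInt_rieszMono hE q (fun l hl => hf l (mem_indices.1 hl)) hx]
  congr 1
  refine integral_congr_ae (Filter.Eventually.of_forall fun y => ?_)
  simp only [dist_eq_norm, taylor_eq_polyJet, polyJet]
  congr 1
  refine Finset.sum_congr rfl fun l hl => ?_
  rw [zero_add, trunc_of_le (mem_indices.1 hl)]

theorem contDiffOn_extOp (hE : IsCompact E) (hμ : MemU υ E μ) (hq : 0 ≤ q)
    (hf : ∀ j, (len j : ℝ) ≤ α → ContinuousOn (f j) E) :
    ContDiffOn ℝ ∞ (extOp E μ q α f) Eᶜ := by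
  have := hμ.prob
  refine ContDiffOn.congr (ContDiffOn.mul ((contDiffOn_hWeight hE q).inv fun x hx =>
    (hμ.hWeight_pos hE hq hx).ne') (ContDiffOn.sum fun l hl => ?_)) fun x hx =>
      extOp_eq_sum hE q hf hx
  exact contDiffOn_kernelInt hE (hf l (mem_indices.1 hl)) (contDiffOn_rieszMono q l)

/-- The weighted average of the constant T_a f(x) is itself; writing it as an expansion about each y
lets it be subtracted coefficient by coefficient. -/
theorem extOp_sub_polyJet (hE : IsCompact E) (hμ : MemU υ E μ) (hα : 0 ≤ α) (hq : 0 ≤ q)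
    (hf : ∀ j, (len j : ℝ) ≤ α → ContinuousOn (f j) E) (a : Eucl n) {x : Eucl n} (hx : x ∉ E) :
    extOp E μ q α f x - polyJet α f a 0 x = (hWeight E μ q x)⁻¹ *
      ∑ l ∈ indices n α, kernelInt E μ (fun y => f l y - polyJet α f a l y) (rieszMono q l) x := by
  have := hμ.prob
  have hp : ∀ l, ContinuousOn (polyJet α f a l) E := fun l =>
    (contDiff_polyJet α f a l).continuous.continuousOn
  have h1 : ∑ l ∈ indices n α, kernelInt E μ (polyJet α f a l) (rieszMono q l) x =
      hWeight E μ q x * polyJet α f a 0 x := by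
    rw [sum_kernelInt_rieszMono hE q (fun l _ => hp l) hx, hWeight_eq, ← integral_mul_const]
    congr 1
    funext y
    rw [polyJet_eq_sum hα f a y x 0]
    simp only [zero_add]
  have h2 : ∀ l ∈ indices n α,
      kernelInt E μ (fun y => f l y - polyJet α f a l y) (rieszMono q l) x =
      kernelInt E μ (f l) (rieszMono q l) x - kernelInt E μ (polyJet α f a l) (rieszMono q l) x := by
    intro l hl
    have hK := (contDiffOn_rieszMono (n := n) q l).continuousOn
    simp only [kernelInt, sub_smul]
    exact integral_sub (integrableOn_kernel hE (hf l (mem_indices.1 hl)) hK hx)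
      (integrableOn_kernel hE (hp l) hK hx)
  rw [Finset.sum_congr rfl h2, Finset.sum_sub_distrib, mul_sub, h1, ← extOp_eq_sum hE q hf hx,
    inv_mul_cancel_left₀ (hμ.hWeight_pos hE hq hx).ne']

/-- Off `E`, the derivatives of `𝓔(f)` are close to those of the Taylor polynomial of `f` at the
nearest point of `E`. -/
theorem MemU.exists_abs_multiDeriv_extOp_sub_le (hE : IsCompact E) (hμ : MemU υ E μ) (hα : 0 < α)
    (hq : υ + α < q) (hf : ∀ j, (len j : ℝ) ≤ α → ContinuousOn (f j) E) {M : ℝ}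
    (hM : ∀ j, (len j : ℝ) ≤ α → ∀ a ∈ E, ∀ y ∈ E,
      |f j y - polyJet α f a j y| ≤ M * ‖a - y‖ ^ (α - len j)) (j : Fin n → ℕ) :
    ∃ C : ℝ, 0 ≤ C ∧ ∀ x ∉ E, ∀ a ∈ E, Metric.infDist x E = ‖x - a‖ →
      |multiDeriv j (extOp E μ q α f) x - polyJet α f a j x| ≤ C * ‖x - a‖ ^ (α - len j) := by
  have := hμ.prob
  have hυ := hμ.exponent_nonneg
  have hq0 : 0 ≤ q := by linarith
  have hU : IsOpen Eᶜ := hE.isClosed.isOpen_compl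
  obtain ⟨A, hA0, hA⟩ := hμ.exists_riesz_le hE hα hq
  choose H hH0 hH using fun m => hμ.exists_norm_iteratedFDeriv_inv_hWeight_le hE hq0 m
  choose K hK0 hK using fun (l : Fin n → ℕ) (m : ℕ) =>
    exists_norm_iteratedFDeriv_kernelInt_rieszMono_le (μ := μ) hE q α l m
  set m := len j with hm
  -- The factor 2^α pays for replacing |a - y| by 2|x - y|.
  set M' : ℝ := |M| * 2 ^ α with hM'
  refine ⟨∑ i ∈ Finset.range (m + 1), (m.choose i : ℝ) * H i *
    (∑ l ∈ indices n α, K l (m - i) * M') * A, ?_, fun x hx a ha hxa => ?_⟩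
  · refine Finset.sum_nonneg fun i _ => mul_nonneg (mul_nonneg (mul_nonneg (Nat.cast_nonneg _)
      (hH0 i)) (Finset.sum_nonneg fun l _ => mul_nonneg (hK0 l _) (by positivity))) hA0.le
  have hd0 : 0 < ‖x - a‖ := norm_sub_pos_of_notMem hx ha
  have hh0 := hμ.hWeight_pos hE hq0 hx
  set c : (Fin n → ℕ) → Eucl n → ℝ := fun l y => f l y - polyJet α f a l y with hc
  have hcc : ∀ l ∈ indices n α, ContinuousOn (c l) E := fun l hl =>
    (hf l (mem_indices.1 hl)).sub (contDiff_polyJet α f a l).continuous.continuousOn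
  have hcB : ∀ l ∈ indices n α, ∀ y ∈ E, |c l y| ≤ M' * ‖x - y‖ ^ (α - len l) := by
    intro l hl y hy
    have hl' := mem_indices.1 hl
    have hay : ‖a - y‖ ≤ 2 * ‖x - y‖ := by
      have h1 : ‖x - a‖ ≤ ‖x - y‖ := hxa ▸ infDist_le_norm hy
      calc ‖a - y‖ = ‖(x - y) - (x - a)‖ := by congr 1; abel
        _ ≤ ‖x - y‖ + ‖x - a‖ := norm_sub_le _ _
        _ ≤ 2 * ‖x - y‖ := by linarith
    have hex : 0 ≤ α - len l := sub_nonneg.2 hl'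
    calc |c l y| ≤ M * ‖a - y‖ ^ (α - len l) := hM l hl' a ha y hy
      _ ≤ |M| * (2 * ‖x - y‖) ^ (α - len l) := by
          gcongr
          exact le_abs_self M
      _ = |M| * 2 ^ (α - len l) * ‖x - y‖ ^ (α - len l) := by
          rw [Real.mul_rpow zero_le_two (norm_nonneg _)]; ring
      _ ≤ |M| * 2 ^ α * ‖x - y‖ ^ (α - len l) := by
          gcongr
          · exact one_le_two
          · linarith [(Nat.cast_nonneg (len l) : (0 : ℝ) ≤ len l)]
  set N : (Fin n → ℕ) → Eucl n → ℝ := fun l => kernelInt E μ (c l) (rieszMono q l) with hN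
  have hNs : ∀ l ∈ indices n α, ContDiffOn ℝ ∞ (N l) Eᶜ := fun l hl =>
    contDiffOn_kernelInt hE (hcc l hl) (contDiffOn_rieszMono q l)
  have hinvs : ContDiffOn ℝ ∞ (fun z => (hWeight E μ q z)⁻¹) Eᶜ :=
    (contDiffOn_hWeight hE q).inv fun z hz => (hμ.hWeight_pos hE hq0 hz).ne'
  set I := ∫ y in E, ‖x - y‖ ^ (α - q) ∂μ with hI
  have hI0 : 0 ≤ I := integral_nonneg fun y => by positivity
  have hNb : ∀ i, ‖iteratedFDeriv ℝ i (fun z => ∑ l ∈ indices n α, N l z) x‖ ≤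
      (∑ l ∈ indices n α, K l i * M') * (‖x - a‖)⁻¹ ^ i * I := by
    intro i
    rw [iteratedFDeriv_fun_sum_apply fun l hl =>
      ((hNs l hl).contDiffAt (hU.mem_nhds hx)).of_le (natCast_le_infty i), Finset.sum_mul,
      Finset.sum_mul]
    refine norm_sum_le_of_le _ fun l hl => ?_
    have := hK l i (c l) M' x (hcc l hl) hx hμ.nonempty (hcB l hl)
    rwa [hxa] at this
  -- Leibniz' rule; in each term 1/h_q cancels the h_q from the potential estimate, and the powers
  -- of 1/d add up to m.
  have hmul := norm_iteratedFDerivWithin_mul_le hinvs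
    (ContDiffOn.sum (f := fun l => N l) (s := indices n α) hNs) hU.uniqueDiffOn hx
    (natCast_le_infty m)
  simp only [iteratedFDerivWithin_of_isOpen _ hU hx] at hmul
  have hgoal : |multiDeriv j (extOp E μ q α f) x - polyJet α f a j x| ≤
      ‖iteratedFDeriv ℝ m (fun z => extOp E μ q α f z - taylor α f a z) x‖ := by
    rw [← multiDeriv_taylor]
    refine abs_multiDeriv_sub_le hU (contDiffOn_extOp hE hμ hq0 hf) ?_ j hx
    rw [show taylor α f a = polyJet α f a 0 from funext (taylor_eq_polyJet α f a)]
    exact (contDiff_polyJet α f a 0).contDiffOn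
  refine hgoal.trans ?_
  have hev : (fun z => extOp E μ q α f z - taylor α f a z) =ᶠ[nhds x]
      fun z => (hWeight E μ q z)⁻¹ * ∑ l ∈ indices n α, N l z := by
    filter_upwards [hU.mem_nhds hx] with z hz
    rw [taylor_eq_polyJet]
    exact extOp_sub_polyJet hE hμ hα.le hq0 hf a hz
  rw [(hev.iteratedFDeriv ℝ m).eq_of_nhds]
  refine hmul.trans ?_
  rw [Finset.sum_mul]
  refine Finset.sum_le_sum fun i hi => ?_
  have him : i ≤ m := Nat.lt_succ_iff.1 (Finset.mem_range.1 hi)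
  have h1 := hH i x hx
  rw [hxa] at h1
  have hA' := hA x hx
  rw [hxa] at hA'
  have hKs : 0 ≤ ∑ l ∈ indices n α, K l (m - i) * M' :=
    Finset.sum_nonneg fun l _ => mul_nonneg (hK0 l _) (by positivity)
  have hHi := hH0 i
  calc (m.choose i : ℝ) * ‖iteratedFDeriv ℝ i (fun z => (hWeight E μ q z)⁻¹) x‖ *
        ‖iteratedFDeriv ℝ (m - i) (fun z => ∑ l ∈ indices n α, N l z) x‖
      ≤ (m.choose i : ℝ) * (H i * (‖x - a‖)⁻¹ ^ i * (hWeight E μ q x)⁻¹) *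
        ((∑ l ∈ indices n α, K l (m - i) * M') * (‖x - a‖)⁻¹ ^ (m - i) *
          (A * ‖x - a‖ ^ α * hWeight E μ q x)) := by
        gcongr
        exact (hNb (m - i)).trans (by gcongr)
    _ = (m.choose i : ℝ) * H i * (∑ l ∈ indices n α, K l (m - i) * M') * A *
        (((‖x - a‖)⁻¹ ^ i * (‖x - a‖)⁻¹ ^ (m - i)) * ‖x - a‖ ^ α) *
          ((hWeight E μ q x)⁻¹ * hWeight E μ q x) := by ring
    _ = _ := by
        rw [inv_mul_cancel₀ hh0.ne', mul_one, ← pow_add, Nat.add_sub_cancel' him,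
          Real.rpow_sub hd0, Real.rpow_natCast, inv_pow, div_eq_inv_mul]

end Extension

/-! ### Comparison of Taylor polynomials at different points -/

/-- At the point `w`, the derivatives of the Taylor polynomials of `G` at `x` and `y` differ by at
most `A ρ^{α - |j|}`. -/
def JetNear (α : ℝ) (G : Jet n) (A ρ : ℝ) (x y w : Eucl n) : Prop :=
  ∀ j, (len j : ℝ) ≤ α → |polyJet α G x j w - polyJet α G y j w| ≤ A * ρ ^ (α - len j)

section JetNear

variable {α A B ρ : ℝ} {G : Jet n} {x y z w : Eucl n}

theorem JetNear.symm (h : JetNear α G A ρ x y w) : JetNear α G A ρ y x w := fun j hj => by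
  rw [abs_sub_comm]
  exact h j hj

theorem JetNear.trans (h : JetNear α G A ρ x y w) (h' : JetNear α G B ρ y z w) :
    JetNear α G (A + B) ρ x z w := fun j hj => by
  rw [add_mul]
  exact (abs_sub_le _ _ _).trans (add_le_add (h j hj) (h' j hj))

/-- Expanding about w, the term of index l is at most A ρ^(α - |j| - |l|) ρ^|l|, so each term has
the right size and only their number enters. -/
theorem JetNear.shift (hα : 0 ≤ α) (hA : 0 ≤ A) (hρ : 0 ≤ ρ) (h : JetNear α G A ρ x y w)
    (hz : ‖z - w‖ ≤ ρ) : JetNear α G ((indices n α).card * A) ρ x y z := fun j hj => by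
  rw [polyJet_eq_sum hα G x w z, polyJet_eq_sum hα G y w z, ← Finset.sum_sub_distrib, mul_assoc,
    ← nsmul_eq_mul]
  refine (Finset.abs_sum_le_sum_abs _ _).trans (Finset.sum_le_card_nsmul _ _ _ fun l _ => ?_)
  rw [← sub_mul, abs_mul]
  by_cases hl : (len (j + l) : ℝ) ≤ α
  · have h1 := h (j + l) hl
    have h2 : |mono l (z - w)| ≤ ρ ^ (len l : ℝ) := by
      rw [Real.rpow_natCast]
      exact (abs_mono_le l _).trans (by gcongr)
    have hjl : (len (j + l) : ℝ) = len j + len l := by rw [len_add]; push_cast; rfl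
    calc _ ≤ A * ρ ^ (α - len (j + l)) * ρ ^ (len l : ℝ) := by gcongr
      _ = A * ρ ^ (α - len j) := by
          rw [mul_assoc, ← Real.rpow_add_of_nonneg hρ (by linarith) (Nat.cast_nonneg _), hjl]
          ring_nf
  · rw [polyJet_of_lt (not_le.1 hl), polyJet_of_lt (not_le.1 hl), sub_zero, abs_zero, zero_mul]
    positivity

theorem JetNear.scale (hA : 0 ≤ A) (hρ : 0 ≤ ρ) (h : JetNear α G A ρ x y w) {k σ : ℝ} (hk : 1 ≤ k)
    (hσ : 0 ≤ σ) (hρσ : ρ ≤ k * σ) : JetNear α G (A * k ^ α) σ x y w := fun j hj => by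
  have hex : 0 ≤ α - len j := sub_nonneg.2 hj
  have hk0 : 0 ≤ k := zero_le_one.trans hk
  calc _ ≤ A * ρ ^ (α - len j) := h j hj
    _ ≤ A * (k * σ) ^ (α - len j) := by gcongr
    _ = A * k ^ (α - len j) * σ ^ (α - len j) := by rw [Real.mul_rpow hk0 hσ, mul_assoc]
    _ ≤ A * k ^ α * σ ^ (α - len j) := by
        gcongr
        linarith [(Nat.cast_nonneg (len j) : (0 : ℝ) ≤ len j)]

theorem JetNear.mono (h : JetNear α G A ρ x y w) (hρ : 0 ≤ ρ) (hAB : A ≤ B) :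
    JetNear α G B ρ x y w := fun j hj =>
  (h j hj).trans (by gcongr)

/-- The whole segment stays at distance at least |x - y| from `E`. Since α - ⌊α⌋ - 1 is negative,
the derivatives of order ⌊α⌋ + 1 are at most A |x - y|^(α - ⌊α⌋ - 1) there, and Taylor's inequality
applies. -/
theorem jetNear_of_segment (hα : 0 ≤ α) {E : Set (Eucl n)}
    (hG : IsDerivFamily (⌊α⌋₊ + 1) Eᶜ G) (hA : 0 ≤ A)
    (hb : ∀ j, len j = ⌊α⌋₊ + 1 → ∀ z ∉ E, |G j z| ≤ A * Metric.infDist z E ^ (α - len j))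
    (hxy : x ≠ y) (hd : 2 * ‖x - y‖ ≤ Metric.infDist x E) :
    JetNear α G ((1 + n) ^ (⌊α⌋₊ + 1) * A) ‖x - y‖ x y x := by
  have hρ : 0 < ‖x - y‖ := norm_pos_iff.2 (sub_ne_zero.2 hxy)
  have hseg : ∀ z ∈ segment ℝ x y, ‖x - y‖ ≤ Metric.infDist z E := by
    intro z hz
    have h1 : dist x z ≤ ‖x - y‖ := by
      rw [← dist_eq_norm]
      have := dist_add_dist_of_mem_segment hz
      linarith [dist_nonneg (x := z) (y := y)]
    have h2 := Metric.infDist_le_infDist_add_dist (s := E) (x := x) (y := z)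
    linarith
  have hsub : segment ℝ x y ⊆ Eᶜ := fun z hz hzE => by
    have := hseg z hz
    rw [Metric.infDist_zero_of_mem hzE] at this
    linarith
  intro j hj
  obtain ⟨p, hp⟩ := Nat.exists_eq_add_of_lt ((lt_floor_add_one_iff hα (len j)).2 hj)
  have hp' : len j + (p + 1) = ⌊α⌋₊ + 1 := by omega
  have key := (hG.mono_set hsub).abs_sub_polyJet_le hα (convex_segment x y)
    (right_mem_segment ℝ x y) (M := A * ‖x - y‖ ^ (α - (⌊α⌋₊ + 1 : ℕ))) (fun k hk z hz => by
      refine (hb k hk z (hsub hz)).trans ?_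
      rw [hk]
      gcongr 1
      refine Real.rpow_le_rpow_of_nonpos hρ (hseg z hz) ?_
      push_cast
      linarith [Nat.lt_floor_add_one α]) hp' (left_mem_segment ℝ x y)
  rw [polyJet_self hα, trunc_of_le hj]
  refine key.trans ?_
  have e : ‖x - y‖ ^ (α - (⌊α⌋₊ + 1 : ℕ)) * ‖x - y‖ ^ (p + 1) = ‖x - y‖ ^ (α - len j) := by
    rw [← Real.rpow_natCast ‖x - y‖ (p + 1), ← Real.rpow_add hρ, ← hp']
    push_cast
    ring_nf
  have hn : (n : ℝ) ^ (p + 1) ≤ (1 + n) ^ (⌊α⌋₊ + 1) :=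
    calc (n : ℝ) ^ (p + 1) ≤ (1 + n) ^ (p + 1) := by gcongr; linarith
      _ ≤ (1 + n) ^ (⌊α⌋₊ + 1) :=
        pow_le_pow_right₀ (le_add_of_nonneg_right (Nat.cast_nonneg n)) (by omega)
  calc (n : ℝ) ^ (p + 1) * (A * ‖x - y‖ ^ (α - (⌊α⌋₊ + 1 : ℕ))) * ‖x - y‖ ^ (p + 1)
      = (n : ℝ) ^ (p + 1) * A * ‖x - y‖ ^ (α - len j) := by rw [← e]; ring
    _ ≤ _ := by gcongr

/-- A jet that satisfies the Lipschitz condition on a compact set `E`, approximates its Taylor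
polynomials at nearest points of `E`, and consists of successive derivatives off `E` with the
natural bound on those of order `⌊α⌋ + 1`, satisfies the Lipschitz condition globally. -/
theorem exists_jetNear_of_compact (hα : 0 ≤ α) {E : Set (Eucl n)} (hE : IsCompact E)
    (hne : E.Nonempty) (hA : 0 ≤ A) (hEE : ∀ x ∈ E, ∀ y ∈ E, JetNear α G A ‖x - y‖ x y x)
    (hnear : ∀ x ∉ E, ∀ a ∈ E, Metric.infDist x E = ‖x - a‖ → JetNear α G A ‖x - a‖ x a x)
    (hG : IsDerivFamily (⌊α⌋₊ + 1) Eᶜ G)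
    (hb : ∀ j, len j = ⌊α⌋₊ + 1 → ∀ z ∉ E, |G j z| ≤ A * Metric.infDist z E ^ (α - len j)) :
    ∃ B : ℝ, 0 ≤ B ∧ ∀ x y, JetNear α G B ‖x - y‖ x y x := by
  set N : ℝ := ((indices n α).card : ℝ) with hN
  have hN0 : 0 ≤ N := Nat.cast_nonneg _
  set B₁ : ℝ := A * 1 ^ α + N * (A * 2 ^ α) * 1 ^ α with hB₁
  have hB₁0 : 0 ≤ B₁ := by positivity
  -- Pass through the nearest point a: x to a by `hnear`, then a to y inside `E`, moved from a to x
  -- by re-expansion.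
  have hout : ∀ x ∉ E, ∀ y ∈ E, JetNear α G B₁ ‖x - y‖ x y x := by
    intro x hx y hy
    obtain ⟨a, ha, hxa⟩ := exists_infDist_eq (x := x) hE hne
    have h1 : ‖x - a‖ ≤ ‖x - y‖ := hxa ▸ infDist_le_norm hy
    have h2 : ‖a - y‖ ≤ 2 * ‖x - y‖ :=
      calc ‖a - y‖ = ‖(x - y) - (x - a)‖ := by congr 1; abel
        _ ≤ ‖x - y‖ + ‖x - a‖ := norm_sub_le _ _
        _ ≤ 2 * ‖x - y‖ := by linarith
    have n1 := (hnear x hx a ha hxa).scale hA (norm_nonneg _) le_rfl (norm_nonneg (x - y))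
      (by linarith)
    have n2 := (((hEE a ha y hy).scale hA (norm_nonneg _) one_le_two (norm_nonneg (x - y)) h2).shift
      hα (by positivity) (norm_nonneg _) h1).scale (by positivity) (norm_nonneg _) le_rfl
      (norm_nonneg (x - y)) (by linarith)
    exact n1.trans n2
  have hin : ∀ x ∈ E, ∀ y ∉ E, JetNear α G (N * B₁) ‖x - y‖ x y x := by
    intro x hx y hy
    have := hout y hy x hx
    rw [norm_sub_rev] at this
    exact (this.shift hα hB₁0 (norm_nonneg _) le_rfl).symm
  set B₂ : ℝ := A * 2 ^ α + N * (B₁ * 3 ^ α) with hB₂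
  have hB₂0 : 0 ≤ B₂ := by positivity
  set B₃ : ℝ := (1 + n) ^ (⌊α⌋₊ + 1) * A with hB₃
  have hB₃0 : 0 ≤ B₃ := by positivity
  have hNB : 0 ≤ N * B₁ := by positivity
  refine ⟨A + B₁ + N * B₁ + B₂ + B₃, by positivity, fun x y => ?_⟩
  have hρ := norm_nonneg (x - y)
  by_cases hx : x ∈ E
  · by_cases hy : y ∈ E
    · exact (hEE x hx y hy).mono hρ (by linarith)
    · exact (hin x hx y hy).mono hρ (by linarith)
  by_cases hy : y ∈ E
  · exact (hout x hx y hy).mono hρ (by linarith)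
  by_cases hxy : x = y
  · subst hxy
    intro j _
    rw [sub_self, abs_zero]
    positivity
  -- Either the segment avoids `E`, or the nearest point a of x is within 2|x - y| of x and 3|x - y|
  -- of y, and serves as intermediate point.
  rcases le_total (2 * ‖x - y‖) (Metric.infDist x E) with hd | hd
  · exact (jetNear_of_segment hα hG hA hb hxy hd).mono hρ (by linarith)
  · obtain ⟨a, ha, hxa⟩ := exists_infDist_eq (x := x) hE hne
    rw [hxa] at hd
    have h3 : ‖y - a‖ ≤ 3 * ‖x - y‖ :=
      calc ‖y - a‖ = ‖(x - a) - (x - y)‖ := by congr 1; abel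
        _ ≤ ‖x - a‖ + ‖x - y‖ := norm_sub_le _ _
        _ ≤ 3 * ‖x - y‖ := by linarith
    have n1 := (hnear x hx a ha hxa).scale hA (norm_nonneg _) one_le_two hρ hd
    have n2 := ((hout y hy a ha).scale hB₁0 (norm_nonneg _) (by norm_num : (1 : ℝ) ≤ 3) hρ h3).shift
      (z := x) hα (by positivity) hρ le_rfl
    exact (n1.trans n2.symm).mono hρ (by linarith)

theorem JetNear.abs_sub_polyJet_le (hα : 0 ≤ α) (h : JetNear α G A ρ x y x) {j : Fin n → ℕ}
    (hj : (len j : ℝ) ≤ α) : |G j x - polyJet α G y j x| ≤ A * ρ ^ (α - len j) := by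
  have := h j hj
  rwa [polyJet_self hα, trunc_of_le hj] at this

end JetNear

/-! ### Consequences of the global Lipschitz condition -/

section Global

variable {α B : ℝ} {G : Jet n}

theorem tendsto_mul_rpow_norm_sub {s : ℝ} (hs : 0 < s) (B : ℝ) (y : Eucl n) :
    Filter.Tendsto (fun x => B * ‖x - y‖ ^ s) (nhds y) (nhds 0) := by
  have h1 : Continuous fun x : Eucl n => B * ‖x - y‖ ^ s :=
    continuous_const.mul ((continuous_id.sub continuous_const).norm.rpow_const fun _ => Or.inr hs.le)
  have := h1.tendsto y
  simpa [Real.zero_rpow hs.ne'] using this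

theorem continuous_of_jetNear (hα : 0 ≤ α) (h : ∀ x y, JetNear α G B ‖x - y‖ x y x)
    {j : Fin n → ℕ} (hj : (len j : ℝ) < α) : Continuous (G j) := by
  rw [continuous_iff_continuousAt]
  intro y
  have h1 : Filter.Tendsto (fun x => G j x - polyJet α G y j x) (nhds y) (nhds 0) :=
    squeeze_zero_norm (fun x => (h x y).abs_sub_polyJet_le hα hj.le)
      (tendsto_mul_rpow_norm_sub (sub_pos.2 hj) B y)
  have h2 := h1.add ((contDiff_polyJet α G y j).continuous.tendsto y)
  simpa [ContinuousAt, polyJet_self hα, trunc_of_le hj.le] using h2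

/-- The strict inequality makes the remainder, of size |x - y|^(α - |j|), negligible against |x -
y|, so `G j` has the derivative of its Taylor polynomial. -/
theorem hasFDerivAt_of_jetNear (hα : 0 ≤ α) (h : ∀ x y, JetNear α G B ‖x - y‖ x y x)
    {j : Fin n → ℕ} (hj : (len j : ℝ) + 1 < α) (y : Eucl n) :
    HasFDerivAt (G j) (∑ i, G (j + Pi.single i 1) y • (EuclideanSpace.proj i : Eucl n →L[ℝ] ℝ)) y := by
  have hj' : (len j : ℝ) ≤ α := by linarith
  have hr : HasFDerivAt (fun x => G j x - polyJet α G y j x) (0 : Eucl n →L[ℝ] ℝ) y := by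
    have h0 : G j y - polyJet α G y j y = 0 := by
      rw [polyJet_self hα, trunc_of_le hj', sub_self]
    rw [hasFDerivAt_iff_isLittleO, h0]
    simp only [sub_zero, zero_apply]
    have hO : (fun x => G j x - polyJet α G y j x) =O[nhds y]
        fun x => ‖x - y‖ ^ (α - len j) := Asymptotics.IsBigO.of_bound B
      (Filter.Eventually.of_forall fun x => by
        have := (h x y).abs_sub_polyJet_le hα hj'
        rwa [Real.norm_eq_abs, Real.norm_of_nonneg (by positivity)])
    refine hO.trans_isLittleO ?_
    rw [← Asymptotics.isLittleO_norm_right]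
    have hlt : (fun x : Eucl n => ‖x - y‖ ^ (α - len j - 1)) =o[nhds y] fun _ => (1 : ℝ) := by
      rw [Asymptotics.isLittleO_one_iff]
      simpa using tendsto_mul_rpow_norm_sub (s := α - len j - 1) (by linarith) 1 y
    have := hlt.mul_isBigO (Asymptotics.isBigO_refl (fun x : Eucl n => ‖x - y‖) (nhds y))
    simp only [one_mul] at this
    refine this.congr_left fun x => ?_
    nth_rw 2 [← Real.rpow_one ‖x - y‖]
    rw [← Real.rpow_add_of_nonneg (norm_nonneg _) (by linarith) zero_le_one, sub_add_cancel]
  have hp := isDerivFamily_polyJet α G y (len j + 1) Set.univ j (Nat.lt_succ_self _) y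
    (Set.mem_univ y)
  have hs := hr.add hp
  have heq : ((fun x => G j x - polyJet α G y j x) + polyJet α G y j) = G j := by
    funext x
    simp
  rw [heq, zero_add] at hs
  refine hs.congr_fderiv (Finset.sum_congr rfl fun i _ => ?_)
  rw [polyJet_self hα, trunc_of_le]
  rw [len_add, len_single]
  push_cast
  exact hj.le

theorem isDerivFamily_of_jetNear (hα : 0 ≤ α) (h : ∀ x y, JetNear α G B ‖x - y‖ x y x) {m : ℕ}
    (hm : (m : ℝ) < α) : IsDerivFamily m Set.univ G := fun j hj y _ =>
  hasFDerivAt_of_jetNear hα h (lt_of_le_of_lt (by exact_mod_cast hj) hm) y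

theorem contDiff_of_jetNear (hα : 0 ≤ α) (h : ∀ x y, JetNear α G B ‖x - y‖ x y x) (k : ℕ)
    (j : Fin n → ℕ) (hk : (len j : ℝ) + k < α) : ContDiff ℝ k (G j) := by
  induction k generalizing j with
  | zero =>
    rw [Nat.cast_zero, contDiff_zero]
    exact continuous_of_jetNear hα h (by simpa using hk)
  | succ k ih =>
    push_cast at hk ⊢
    rw [contDiff_succ_iff_hasFDerivAt]
    refine ⟨_, ContDiff.sum fun i _ => ContDiff.smul (ih (j + Pi.single i 1) ?_) contDiff_const,
      fun y => hasFDerivAt_of_jetNear hα h ?_ y⟩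
    · rw [len_add, len_single]
      push_cast
      linarith
    · linarith [(Nat.cast_nonneg k : (0 : ℝ) ≤ k)]

end Global

/-! ### The Lipschitz norm -/

section LipNorm

variable {α : ℝ} {S : Set (Eucl n)} {f : Jet n}

theorem lipNorm_ne_top {B : ℝ} (hb : ∀ j, (len j : ℝ) ≤ α → ∀ x ∈ S, |f j x| ≤ B)
    (hr : ∀ j, (len j : ℝ) ≤ α → ∀ x ∈ S, ∀ y ∈ S,
      |f j x - polyJet α f y j x| ≤ B * ‖x - y‖ ^ (α - len j)) : lipNorm α S f ≠ ⊤ := by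
  refine ENNReal.sum_ne_top.2 fun j hj => ENNReal.add_ne_top.2 ⟨?_, ?_⟩
  · refine ne_top_of_le_ne_top ENNReal.ofReal_ne_top (b := ENNReal.ofReal B) ?_
    exact iSup₂_le fun x hx => ENNReal.ofReal_le_ofReal (hb j (mem_indices.1 hj) x hx)
  · refine ne_top_of_le_ne_top ENNReal.ofReal_ne_top (b := ENNReal.ofReal B) ?_
    refine iSup₂_le fun x hx => iSup₂_le fun y hy => ENNReal.ofReal_le_ofReal ?_
    rw [remainder_eq, dist_eq_norm]
    have hB : 0 ≤ B := (abs_nonneg _).trans (hb j (mem_indices.1 hj) x hx)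
    exact div_le_of_le_mul₀ (by positivity) hB (hr j (mem_indices.1 hj) x hx y hy)

theorem MemLip.exists_bounds (hα : 0 ≤ α) (hf : MemLip α S f) :
    ∃ M : ℝ, 0 ≤ M ∧ (∀ j, (len j : ℝ) ≤ α → ∀ x ∈ S, |f j x| ≤ M) ∧
      ∀ j, (len j : ℝ) ≤ α → ∀ x ∈ S, ∀ y ∈ S,
        |f j x - polyJet α f y j x| ≤ M * ‖x - y‖ ^ (α - len j) := by
  have hle : ∀ j, (len j : ℝ) ≤ α →
      ((⨆ x ∈ S, ENNReal.ofReal |f j x|) + ⨆ x ∈ S, ⨆ y ∈ S,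
        ENNReal.ofReal (|remainder α f j y x| / dist x y ^ (α - (len j : ℝ)))) ≤ lipNorm α S f :=
    fun j hj => Finset.single_le_sum
      (f := fun j => (⨆ x ∈ S, ENNReal.ofReal |f j x|) + ⨆ x ∈ S, ⨆ y ∈ S,
        ENNReal.ofReal (|remainder α f j y x| / dist x y ^ (α - (len j : ℝ))))
      (fun _ _ => zero_le) (mem_indices.2 hj)
  refine ⟨(lipNorm α S f).toReal, ENNReal.toReal_nonneg, fun j hj x hx => ?_,
    fun j hj x hx y hy => ?_⟩
  · rw [← ENNReal.ofReal_le_iff_le_toReal hf.2]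
    exact (le_iSup₂ (f := fun x (_ : x ∈ S) => ENNReal.ofReal |f j x|) x hx).trans
      (le_self_add.trans (hle j hj))
  · by_cases hxy : x = y
    · subst hxy
      rw [polyJet_self hα, trunc_of_le hj, sub_self, abs_zero]
      positivity
    · have hpos : 0 < ‖x - y‖ := norm_pos_iff.2 (sub_ne_zero.2 hxy)
      rw [← div_le_iff₀ (by positivity), ← remainder_eq, ← dist_eq_norm,
        ← ENNReal.ofReal_le_iff_le_toReal hf.2]
      refine le_trans ?_ (le_add_self.trans (hle j hj))
      refine le_trans ?_ (le_iSup₂ (f := fun x (_ : x ∈ S) => ⨆ y ∈ S,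
        ENNReal.ofReal (|remainder α f j y x| / dist x y ^ (α - (len j : ℝ)))) x hx)
      exact le_iSup₂ (f := fun y (_ : y ∈ S) =>
        ENNReal.ofReal (|remainder α f j y x| / dist x y ^ (α - (len j : ℝ)))) y hy

end LipNorm

section Bounded

variable {α A : ℝ} {G : Jet n}

theorem exists_bound_of_forall_index {S : Set (Eucl n)}
    (h : ∀ j, (len j : ℝ) ≤ α → ∃ B : ℝ, ∀ x ∈ S, |G j x| ≤ B) :
    ∃ B : ℝ, 0 ≤ B ∧ ∀ j, (len j : ℝ) ≤ α → ∀ x ∈ S, |G j x| ≤ B := by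
  have h' : ∀ j : Fin n → ℕ, ∃ B : ℝ, (len j : ℝ) ≤ α → ∀ x ∈ S, |G j x| ≤ B := fun j => by
    by_cases hj : (len j : ℝ) ≤ α
    · obtain ⟨B, hB⟩ := h j hj
      exact ⟨B, fun _ => hB⟩
    · exact ⟨0, fun h => absurd h hj⟩
  choose B hB using h'
  refine ⟨∑ j ∈ indices n α, |B j|, Finset.sum_nonneg fun _ _ => abs_nonneg _, fun j hj x hx => ?_⟩
  exact (hB j hj x hx).trans ((le_abs_self _).trans
    (Finset.single_le_sum (f := fun j => |B j|) (fun _ _ => abs_nonneg _) (mem_indices.2 hj)))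

/-- Comparison with the Taylor polynomial at 0 also covers the components with |j| = α, which need
not be continuous. -/
theorem exists_bound_of_jetNear (hα : 0 ≤ α) (h : ∀ x y, JetNear α G A ‖x - y‖ x y x) (R : ℝ) :
    ∃ B : ℝ, 0 ≤ B ∧ ∀ j, (len j : ℝ) ≤ α → ∀ x ∈ Metric.ball (0 : Eucl n) R, |G j x| ≤ B := by
  refine exists_bound_of_forall_index fun j hj => ?_
  have hc : Continuous fun x : Eucl n => |polyJet α G 0 j x| + A * ‖x - 0‖ ^ (α - len j) :=
    (contDiff_polyJet α G 0 j).continuous.abs.add (continuous_const.mul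
      ((continuous_id.sub continuous_const).norm.rpow_const fun _ => Or.inr (sub_nonneg.2 hj)))
  obtain ⟨B, hB⟩ := (isCompact_closedBall (0 : Eucl n) R).exists_bound_of_continuousOn
    hc.continuousOn
  refine ⟨B, fun x hx => ?_⟩
  refine le_trans ?_ ((le_abs_self _).trans (hB x (Metric.ball_subset_closedBall hx)))
  have h1 := (h x 0).abs_sub_polyJet_le hα hj
  have h2 := abs_sub_abs_le_abs_sub (G j x) (polyJet α G 0 j x)
  linarith

/-- Changing the components of top order `|j| = α` of a jet by bounded functions does not affect
the Lipschitz condition. -/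
theorem abs_sub_polyJet_le_of_eq_lower {G' : Jet n} {S : Set (Eucl n)} {B : ℝ}
    (hlow : ∀ j, (len j : ℝ) < α → G' j = G j)
    (hB : ∀ j, (len j : ℝ) ≤ α → ∀ x ∈ S, |G' j x - G j x| ≤ B)
    (h : ∀ j, (len j : ℝ) ≤ α → ∀ x ∈ S, ∀ y ∈ S,
      |G j x - polyJet α G y j x| ≤ A * ‖x - y‖ ^ (α - len j))
    {j : Fin n → ℕ} (hj : (len j : ℝ) ≤ α) {x y : Eucl n} (hx : x ∈ S) (hy : y ∈ S) :
    |G' j x - polyJet α G' y j x| ≤ (A + B + (indices n α).card * B) * ‖x - y‖ ^ (α - len j) := by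
  have hB0 : 0 ≤ B := (abs_nonneg _).trans (hB j hj x hx)
  have h1 : |G' j x - G j x| ≤ B * ‖x - y‖ ^ (α - len j) := by
    rcases hj.lt_or_eq with hlt | heq
    · rw [hlow j hlt, sub_self, abs_zero]
      positivity
    · rw [heq, sub_self, Real.rpow_zero, mul_one]
      exact hB j hj x hx
  have h2 : |polyJet α G' y j x - polyJet α G y j x| ≤
      (indices n α).card * B * ‖x - y‖ ^ (α - len j) := by
    rw [polyJet, polyJet, ← Finset.sum_sub_distrib, mul_assoc, ← nsmul_eq_mul]
    refine (Finset.abs_sum_le_sum_abs _ _).trans (Finset.sum_le_card_nsmul _ _ _ fun l _ => ?_)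
    rw [← sub_mul, abs_mul]
    rcases lt_trichotomy (len (j + l) : ℝ) α with hlt | heq | hgt
    · rw [trunc_of_le hlt.le, trunc_of_le hlt.le, hlow _ hlt, sub_self, abs_zero, zero_mul]
      positivity
    · rw [trunc_of_le heq.le, trunc_of_le heq.le]
      -- A changed coefficient multiplies a monomial of degree exactly α - |j|, which supplies the
      -- required power.
      have e : α - len j = (len l : ℝ) := by
        rw [← heq, len_add]
        push_cast
        ring
      rw [e, Real.rpow_natCast]
      gcongr
      · exact hB _ heq.le y hy
      · exact abs_mono_le l _
    · rw [trunc_of_lt hgt, trunc_of_lt hgt, sub_self, abs_zero, zero_mul]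
      positivity
  have h3 := h j hj x hx y hy
  have e : G' j x - polyJet α G' y j x = (G j x - polyJet α G y j x) + (G' j x - G j x) -
      (polyJet α G' y j x - polyJet α G y j x) := by ring
  rw [e]
  refine (abs_sub _ _).trans ?_
  refine (add_le_add (abs_add_le _ _) le_rfl).trans ?_
  linarith

theorem polyJet_congr {f g : Jet n} {a : Eucl n} (h : ∀ j, (len j : ℝ) ≤ α → f j a = g j a) :
    polyJet α f a = polyJet α g a := by
  funext j x
  refine Finset.sum_congr rfl fun l _ => ?_
  rw [trunc, trunc]
  split_ifs with hl
  · rw [h _ hl]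
  · rfl

end Bounded

/-! ### The glued jet -/

section Main

variable {υ α q : ℝ} {E : Set (Eucl n)} {μ : Measure (Eucl n)} {f : Jet n}

theorem extJet_of_mem {j : Fin n → ℕ} {x : Eucl n} (hx : x ∈ E) :
    extJet E μ q α f j x = f j x := by
  simp [extJet, hx]

theorem extJet_of_notMem {j : Fin n → ℕ} {x : Eucl n} (hx : x ∉ E) :
    extJet E μ q α f j x = multiDeriv j (extOp E μ q α f) x := by
  simp [extJet, hx]

theorem multiDeriv_zero (F : Eucl n → ℝ) : multiDeriv 0 F = F := by
  rw [multiDeriv_eq_listDeriv]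
  have : directions (0 : Fin n → ℕ) = [] := List.length_eq_zero_iff.1 (by simp [length_directions])
  rw [this]
  rfl

theorem extFun_eq_extJet : extFun E μ q α f = extJet E μ q α f 0 := by
  funext x
  simp [extFun, extJet, multiDeriv_zero]

theorem isDerivFamily_extJet (hE : IsCompact E) (hμ : MemU υ E μ) (hq : 0 ≤ q)
    (hf : ∀ j, (len j : ℝ) ≤ α → ContinuousOn (f j) E) (m : ℕ) :
    IsDerivFamily m Eᶜ (extJet E μ q α f) := by
  have hU : IsOpen Eᶜ := hE.isClosed.isOpen_compl
  intro j hj z hz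
  have h := isDerivFamily_multiDeriv hU (contDiffOn_extOp hE hμ hq hf) m j hj z hz
  have heq : Set.EqOn (extJet E μ q α f j) (multiDeriv j (extOp E μ q α f)) Eᶜ :=
    fun x hx => extJet_of_notMem hx
  refine (h.congr_of_eventuallyEq (heq.eventuallyEq_of_mem (hU.mem_nhds hz))).congr_fderiv ?_
  simp only [extJet_of_notMem hz]

theorem MemU.exists_jetNear_extJet (hE : IsCompact E) (hμ : MemU υ E μ) (hα : 0 < α)
    (hq : υ + α < q) (hf : MemLip α E f) :
    ∃ B : ℝ, 0 ≤ B ∧ ∀ x y, JetNear α (extJet E μ q α f) B ‖x - y‖ x y x := by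
  have hυ := hμ.exponent_nonneg
  obtain ⟨M, hM0, -, hM⟩ := hf.exists_bounds hα.le
  choose C hC0 hC using fun j => hμ.exists_abs_multiDeriv_extOp_sub_le hE hα hq hf.1
    (fun j hj a ha y hy => by rw [norm_sub_rev]; exact hM j hj y hy a ha) j
  have hpoly : ∀ a ∈ E, polyJet α (extJet E μ q α f) a = polyJet α f a := fun a ha =>
    polyJet_congr fun j _ => extJet_of_mem ha
  -- The sum runs up to α + 1 in order to include the order ⌊α⌋ + 1.
  set A : ℝ := M + ∑ j ∈ indices n (α + 1), C j with hA
  have hMA : M ≤ A := le_add_of_nonneg_right (Finset.sum_nonneg fun j _ => hC0 j)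
  have hCA : ∀ j, (len j : ℝ) ≤ α + 1 → C j ≤ A := fun j hj =>
    (Finset.single_le_sum (fun j _ => hC0 j) (mem_indices.2 hj)).trans (le_add_of_nonneg_left hM0)
  refine exists_jetNear_of_compact hα.le hE hμ.nonempty (hM0.trans hMA) ?_ ?_
    (isDerivFamily_extJet hE hμ (by linarith) hf.1 _) ?_
  · intro x hx y hy j hj
    rw [hpoly x hx, hpoly y hy, polyJet_self hα.le, trunc_of_le hj]
    exact (hM j hj x hx y hy).trans (by gcongr)
  · intro x hx a ha hxa j hj
    rw [hpoly a ha, polyJet_self hα.le, trunc_of_le hj, extJet_of_notMem hx]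
    refine (hC j x hx a ha hxa).trans ?_
    gcongr
    exact hCA j (by linarith)
  · intro j hj z hz
    obtain ⟨a, ha, hza⟩ := exists_infDist_eq (x := z) hE hμ.nonempty
    have h1 := hC j z hz a ha hza
    rw [polyJet_of_lt (by rw [hj]; exact_mod_cast Nat.lt_floor_add_one α), sub_zero] at h1
    rw [extJet_of_notMem hz, hza]
    refine h1.trans ?_
    gcongr
    refine hCA j ?_
    rw [hj]
    push_cast
    linarith [Nat.floor_le hα.le]

/-- A jet of continuous functions that extends `f` and agrees with the glued jet in order less
than `α`; the components of order `α` are any continuous extensions. -/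
theorem exists_continuous_extension (hE : IsClosed E)
    (hf : ∀ j, (len j : ℝ) ≤ α → ContinuousOn (f j) E) {F : Jet n}
    (hF : ∀ j, (len j : ℝ) < α → Continuous (F j)) (hFf : ∀ j, ∀ x ∈ E, F j x = f j x) :
    ∃ G : Jet n, (∀ j, (len j : ℝ) < α → G j = F j) ∧
      (∀ j, (len j : ℝ) ≤ α → Set.EqOn (G j) (f j) E) ∧
      ∀ j, (len j : ℝ) ≤ α → Continuous (G j) := by
  have h : ∀ j : Fin n → ℕ, ∃ g : Eucl n → ℝ, ((len j : ℝ) < α → g = F j) ∧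
      ((len j : ℝ) ≤ α → Set.EqOn g (f j) E) ∧ ((len j : ℝ) ≤ α → Continuous g) := by
    intro j
    rcases lt_trichotomy (len j : ℝ) α with hlt | heq | hgt
    · exact ⟨F j, fun _ => rfl, fun _ x hx => hFf j x hx, fun _ => hF j hlt⟩
    -- Tietze's extension theorem for the top-order component, which is continuous on the closed set
    -- `E`.
    · obtain ⟨g, hg⟩ := ContinuousMap.exists_restrict_eq hE
        ⟨E.domRestrict (f j), (hf j heq.le).domRestrict⟩
      refine ⟨g, fun h => absurd heq h.ne, fun _ x hx => ?_, fun _ => g.continuous⟩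
      exact DFunLike.congr_fun hg ⟨x, hx⟩
    · exact ⟨0, fun h => absurd h hgt.not_gt, fun h => absurd h hgt.not_ge,
        fun h => absurd h hgt.not_ge⟩
  choose G h1 h2 h3 using h
  exact ⟨G, h1, h2, h3⟩

end Main

end WhitneyDoubling

end

theorem theorem4 {n : ℕ} (E : Set (WhitneyDoubling.Eucl n)) (hE : IsCompact E)
    (υ α q : ℝ) (hα : 0 < α) (hq : υ + α < q)
    (μ : MeasureTheory.Measure (WhitneyDoubling.Eucl n)) (hμ : WhitneyDoubling.MemU υ E μ)
    (f : WhitneyDoubling.Jet n) (hf : WhitneyDoubling.MemLip α E f) :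
    -- off `E`, the function `𝓔(f)` is smooth
    ContDiffOn ℝ ∞ (WhitneyDoubling.extOp E μ q α f) Eᶜ ∧
    -- `g` is of class `C^k` on `ℝⁿ` for every integer `k < α`
    (∀ k : ℕ, (k : ℝ) < α → ContDiff ℝ k (WhitneyDoubling.extFun E μ q α f)) ∧
    -- its derivatives of order less than `α` are the components of the glued jet
    (∀ j : Fin n → ℕ, (WhitneyDoubling.len j : ℝ) < α → ∀ x,
      WhitneyDoubling.multiDeriv j (WhitneyDoubling.extFun E μ q α f) x =
        WhitneyDoubling.extJet E μ q α f j x) ∧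
    -- on every ball the glued jet has finite norm, and lies in `Lip_α` if `α` is not an integer
    (∀ R : ℝ, 0 < R →
      WhitneyDoubling.lipNorm α (Metric.ball 0 R) (WhitneyDoubling.extJet E μ q α f) ≠ ⊤) ∧
    ((∀ m : ℕ, α ≠ m) → ∀ R : ℝ, 0 < R →
      WhitneyDoubling.MemLip α (Metric.ball 0 R) (WhitneyDoubling.extJet E μ q α f)) ∧
    -- for every `α`, `g` belongs to `Lip_α` of every ball, through a jet that extends `f`
    ∃ G : WhitneyDoubling.Jet n,
      (∀ j : Fin n → ℕ, (WhitneyDoubling.len j : ℝ) < α →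
        G j = WhitneyDoubling.extJet E μ q α f j) ∧
      (∀ j : Fin n → ℕ, (WhitneyDoubling.len j : ℝ) ≤ α → Set.EqOn (G j) (f j) E) ∧
      ∀ R : ℝ, 0 < R → WhitneyDoubling.MemLip α (Metric.ball 0 R) G := by
  open WhitneyDoubling in
  have hυ := hμ.exponent_nonneg
  obtain ⟨A, hA0, hA⟩ := hμ.exists_jetNear_extJet hE hα hq hf
  have hcont : ∀ j : Fin n → ℕ, (len j : ℝ) < α → Continuous (extJet E μ q α f j) :=
    fun j hj => continuous_of_jetNear hα.le hA hj
  have hrem : ∀ j, (len j : ℝ) ≤ α → ∀ x y : Eucl n,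
      |extJet E μ q α f j x - polyJet α (extJet E μ q α f) y j x| ≤
        A * ‖x - y‖ ^ (α - len j) :=
    fun j hj x y => (hA x y).abs_sub_polyJet_le hα.le hj
  have hnorm : ∀ R : ℝ, lipNorm α (Metric.ball 0 R) (extJet E μ q α f) ≠ ⊤ := by
    intro R
    obtain ⟨B, hB0, hB⟩ := exists_bound_of_jetNear hα.le hA R
    refine lipNorm_ne_top (B := A + B) (fun j hj x hx => (hB j hj x hx).trans (by linarith))
      fun j hj x _ y _ => (hrem j hj x y).trans ?_
    gcongr
    linarith
  refine ⟨contDiffOn_extOp hE hμ (by linarith) hf.1, fun k hk => ?_, fun j hj x => ?_,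
    fun R _ => hnorm R, fun hnint R _ => ⟨fun j hj => ?_, hnorm R⟩, ?_⟩
  · rw [extFun_eq_extJet]
    exact contDiff_of_jetNear hα.le hA k 0 (by simpa using hk)
  · rw [extFun_eq_extJet]
    exact (isDerivFamily_of_jetNear hα.le hA hj).multiDeriv_eqOn isOpen_univ le_rfl (Set.mem_univ x)
  -- For non-integer α no multi-index has length exactly α, so every component is already
  -- continuous.
  · exact (hcont j (lt_of_le_of_ne hj (hnint _).symm)).continuousOn
  · obtain ⟨G, hlow, hGf, hGc⟩ := exists_continuous_extension hE.isClosed hf.1 hcont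
      fun j x hx => extJet_of_mem hx
    refine ⟨G, hlow, hGf, fun R _ => ⟨fun j hj => (hGc j hj).continuousOn, ?_⟩⟩
    obtain ⟨B, hB0, hB⟩ := exists_bound_of_jetNear hα.le hA R
    obtain ⟨B', hB'0, hB'⟩ := exists_bound_of_forall_index (α := α) (G := G)
      (S := Metric.ball (0 : Eucl n) R) fun j hj => by
        obtain ⟨b, hb⟩ := (isCompact_closedBall (0 : Eucl n) R).exists_bound_of_continuousOn
          (hGc j hj).continuousOn
        exact ⟨b, fun x hx => hb x (Metric.ball_subset_closedBall hx)⟩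
    have hdiff : ∀ j, (len j : ℝ) ≤ α → ∀ x ∈ Metric.ball (0 : Eucl n) R,
        |G j x - extJet E μ q α f j x| ≤ B' + B := fun j hj x hx =>
      (abs_sub _ _).trans (add_le_add (hB' j hj x hx) (hB j hj x hx))
    have hN : (0 : ℝ) ≤ (indices n α).card * (B' + B) := by positivity
    refine lipNorm_ne_top (B := A + (B' + B) + (indices n α).card * (B' + B))
      (fun j hj x hx => (hB' j hj x hx).trans (by linarith)) fun j hj x hx y hy => ?_
    exact abs_sub_polyJet_le_of_eq_lower hlow hdiff (fun j hj x _ y _ => hrem j hj x y) hj hx hy
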